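/- Theorem B. A complex algebra is a complex vector space with a bilinear product. It is \emph{bicommutative} if $(xy)z=(xz)y$ and $x(yz)=y(xz)$ for all $x,y,z$; it is \emph{nilpotent} if for some $n\ge 1$ every product of $n$ elements, with any bracketing, is zero; it is \emph{one-generated} if it is generated, as an algebra, by a single element. Let $\mathcal B$ be a $6$-dimensional complex one-generated nilpotent bicommutative algebra. Then $\mathcal B$ is isomorphic to an algebra from the following list. Each of these algebras is given in a basis $e_1,\dots,e_6$ by its nonzero products of basis vectors (a product that is not shown is zero), and the parameters $\lambda,\mu$ run over $\mathbb C$, with the restriction $\lambda\ne 0$ where indicated. - $B^6_{01}$: $e_1e_1=e_2, e_1e_2=e_4, e_1e_4=e_5, e_2e_1=e_3, e_3e_1=e_6$; - $B^6_{02}(\lambda)$: $e_1e_1=e_2, e_1e_2=e_4, e_1e_3=e_6, e_1e_4=e_5, e_2e_1=e_3, e_2e_2=e_6, e_3e_1=\lambda e_6, e_4e_1=e_6$; - $B^6_{03}(\lambda,\mu)$: $e_1e_1=e_2, e_1e_2=e_4, e_1e_3=e_6, e_1e_4=\lambda e_5+\mu e_6, e_2e_1=e_3, e_2e_2=e_6,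 e_3e_1=e_5, e_4e_1=e_6$; - $B^6_{04}$: $e_1e_1=e_2, e_1e_2=e_4, e_1e_3=e_6, e_2e_1=e_3, e_2e_2=e_6, e_3e_1=e_4+e_5, e_4e_1=e_6$; - $B^6_{05}$: $e_1e_1=e_2, e_1e_2=e_5, e_2e_1=e_3, e_3e_1=e_4, e_4e_1=e_6$; - $B^6_{06}$: $e_1e_1=e_2, e_1e_2=e_3, e_1e_3=e_4, e_1e_4=e_6, e_2e_1=e_4+e_5, e_2e_2=e_6, e_3e_1=e_6$; - $B^6_{07}$: $e_1e_1=e_2, e_1e_2=e_3, e_1e_3=e_4, e_1e_4=e_6, e_2e_1=e_3+e_4+e_5, e_2e_2=e_4+e_6, e_2e_3=e_6, e_3e_1=e_4+e_6, e_3e_2=e_6, e_4e_1=e_6$; - $B^6_{08}(\lambda)$: $e_1e_1=e_2, e_1e_2=e_3, e_1e_3=e_4, e_1e_4=e_6, e_2e_1=\lambda e_3+e_5, e_2e_2=\lambda e_4, e_2e_3=\lambda e_6, e_3e_1=\lambda e_4, e_3e_2=\lambda e_6, e_4e_1=\lambda e_6$; - $B^6_{09}(\lambda)$: $e_1e_1=e_2,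 e_1e_2=e_4, e_1e_3=e_6, e_1e_4=\lambda e_6, e_2e_1=e_3, e_2e_2=e_6, e_3e_1=e_5, e_4e_1=e_6, e_5e_1=e_6$; - $B^6_{10}$: $e_1e_1=e_2, e_1e_2=e_4, e_1e_4=e_6, e_2e_1=e_3, e_3e_1=e_5, e_5e_1=e_6$; - $B^6_{11}$: $e_1e_1=e_2, e_1e_2=e_4, e_2e_1=e_3, e_3e_1=e_5, e_5e_1=e_6$; - $B^6_{12}(\lambda)$: $e_1e_1=e_2, e_1e_2=e_3, e_1e_3=e_5, e_1e_5=e_6, e_2e_1=\lambda e_3+e_4, e_2e_2=\lambda e_5, e_2e_3=\lambda e_6, e_3e_1=\lambda e_5, e_3e_2=\lambda e_6, e_5e_1=\lambda e_6$; - $B^6_{13}(\lambda)$: $e_1e_1=e_2, e_1e_2=e_3, e_1e_3=e_5, e_1e_5=e_6, e_2e_1=\lambda e_3+e_4, e_2e_2=\lambda e_5, e_2e_3=\lambda e_6, e_3e_1=\lambda e_5, e_3e_2=\lambda e_6, e_4e_1=e_6, e_5e_1=\lambda e_6$; - $B^6_{14}(\lambda)$: $e_1e_1=e_2, e_1e_2=e_3,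 e_1e_3=e_5, e_1e_4=e_6, e_1e_5=e_6, e_2e_1=e_4, e_2e_2=e_6, e_3e_1=e_6, e_4e_1=\lambda e_6$; - $B^6_{15}(\lambda)$: $e_1e_1=e_2, e_1e_2=e_3, e_1e_3=e_5, e_1e_4=e_6, e_1e_5=e_6, e_2e_1=e_3+e_4, e_2e_2=e_5+e_6, e_2e_3=e_6, e_3e_1=e_5+e_6, e_3e_2=e_6, e_4e_1=\lambda e_6, e_5e_1=e_6$; - $B^6_{16}(\lambda)$ ($\lambda\neq 0$): $e_1e_1=e_2, e_1e_2=e_4, e_1e_3=e_5, e_1e_4=\lambda e_5, e_1e_5=\lambda e_6, e_2e_1=e_3, e_2e_2=e_5, e_2e_3=e_6, e_2e_4=\lambda e_6, e_3e_1=\lambda^{-1} e_5, e_3e_2=e_6, e_4e_1=e_5, e_4e_2=\lambda e_6, e_5e_1=e_6$; - $B^6_{17}(\lambda)$ ($\lambda\neq 0$): $e_1e_1=e_2, e_1e_2=e_4, e_1e_3=e_5, e_1e_4=\lambda e_5+e_6, e_1e_5=\lambda e_6, e_2e_1=e_3, e_2e_2=e_5, e_2e_3=e_6, e_2e_4=\lambda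 e_6, e_3e_1=\lambda^{-1} e_5, e_3e_2=e_6, e_4e_1=e_5, e_4e_2=\lambda e_6, e_5e_1=e_6$; - $B^6_{18}(\lambda)$: $e_1e_1=e_2, e_1e_2=e_4, e_1e_3=e_5, e_1e_4=e_5+\lambda e_6, e_1e_5=e_6, e_2e_1=e_3, e_2e_2=e_5, e_2e_3=e_6, e_2e_4=e_6, e_3e_1=e_5+e_6, e_3e_2=e_6, e_4e_1=e_5, e_4e_2=e_6, e_5e_1=e_6$; - $B^6_{19}$: $e_1e_1=e_2, e_1e_2=e_4, e_1e_3=e_5, e_1e_4=e_6, e_2e_1=e_3, e_2e_2=e_5, e_2e_3=e_6, e_3e_1=e_4, e_3e_2=e_6, e_4e_1=e_5, e_5e_1=e_6$; - $B^6_{20}$: $e_1e_1=e_2, e_1e_2=e_5, e_1e_3=e_6, e_2e_1=e_3, e_2e_2=e_6, e_3e_1=e_4, e_4e_1=e_5, e_5e_1=e_6$; - $B^6_{21}$: $e_1e_1=e_2, e_1e_2=e_6, e_2e_1=e_3, e_3e_1=e_4, e_4e_1=e_5, e_5e_1=e_6$; - $B^6_{22}$: $e_1e_1=e_2, e_2e_1=e_3,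 e_3e_1=e_4, e_4e_1=e_5, e_5e_1=e_6$; - $B^6_{23}$: $e_1e_1=e_2, e_1e_2=e_3, e_1e_3=e_4, e_1e_4=e_5, e_1e_5=e_6, e_2e_1=e_4, e_2e_2=e_5, e_2e_3=e_6, e_3e_1=e_5, e_3e_2=e_6, e_4e_1=e_6$; - $B^6_{24}$: $e_1e_1=e_2, e_1e_2=e_3, e_1e_3=e_4, e_1e_4=e_5, e_1e_5=e_6, e_2e_1=e_3+e_4, e_2e_2=e_4+e_5, e_2e_3=e_5+e_6, e_2e_4=e_6, e_3e_1=e_4+e_5, e_3e_2=e_5+e_6, e_3e_3=e_6, e_4e_1=e_5+e_6, e_4e_2=e_6, e_5e_1=e_6$; - $B^6_{25}(\lambda)$: $e_1e_1=e_2, e_1e_2=e_3, e_1e_3=e_4, e_1e_4=e_5, e_1e_5=e_6, e_2e_1=\lambda e_3, e_2e_2=\lambda e_4, e_2e_3=\lambda e_5, e_2e_4=\lambda e_6, e_3e_1=\lambda e_4, e_3e_2=\lambda e_5, e_3e_3=\lambda e_6, e_4e_1=\lambda e_5, e_4e_2=\lambda e_6, e_5e_1=\lambda e_6$; - $B^6_{26}$: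 $e_1e_1=e_2, e_1e_2=e_3, e_1e_3=e_4, e_1e_4=e_5, e_1e_5=e_6, e_2e_1=e_6$; - $B^6_{27}$: $e_1e_1=e_2, e_1e_2=e_3, e_1e_3=e_4, e_1e_4=e_5, e_1e_5=e_6, e_2e_1=e_3+e_6, e_2e_2=e_4, e_2e_3=e_5, e_2e_4=e_6, e_3e_1=e_4, e_3e_2=e_5, e_3e_3=e_6, e_4e_1=e_5, e_4e_2=e_6, e_5e_1=e_6$; - $B^6_{28}$: $e_1e_1=e_2, e_1e_2=e_3, e_1e_3=e_4, e_1e_4=e_5, e_1e_5=e_6, e_2e_1=e_5, e_2e_2=e_6, e_3e_1=e_6$; - $B^6_{29}$: $e_1e_1=e_2, e_1e_2=e_3, e_1e_3=e_4, e_1e_4=e_5, e_1e_5=e_6, e_2e_1=e_3+e_5, e_2e_2=e_4+e_6, e_2e_3=e_5, e_2e_4=e_6, e_3e_1=e_4+e_6, e_3e_2=e_5, e_3e_3=e_6, e_4e_1=e_5, e_4e_2=e_6, e_5e_1=e_6$. -/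

import Mathlib

namespace Bicomm

section Notions

variable (A : Type*) [NonUnitalNonAssocRing A]

/-- Right- and left-commutativity: `(xy)z = (xz)y` and `x(yz) = y(xz)`. -/
def IsBicommutative : Prop :=
  (∀ x y z : A, (x * y) * z = (x * z) * y) ∧ (∀ x y z : A, x * (y * z) = y * (x * z))

variable {A} in
/-- `IsProduct n x`: the element `x` is a product of `n` elements, bracketed in some way. -/
inductive IsProduct : ℕ → A → Prop
  | of (x : A) : IsProduct 1 x
  | mul {p q : ℕ} {x y : A} : IsProduct p x → IsProduct q y → IsProduct (p + q) (x * y)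

/-- For some `n ≥ 1`, every product of `n` elements, however bracketed, is zero. -/
def IsNilpotentAlgebra : Prop :=
  ∃ n : ℕ, 1 ≤ n ∧ ∀ x : A, IsProduct n x → x = 0

variable [Module ℂ A]

/-- Some element of `A` is contained in no proper (non-unital) subalgebra. -/
def IsOneGenerated [IsScalarTower ℂ A A] [SMulCommClass ℂ A A] : Prop :=
  ∃ x : A, NonUnitalAlgebra.adjoin ℂ {x} = ⊤

/-- Isomorphism of complex algebras: a linear bijection that respects the products. -/
def Isomorphic (B : Type*) [NonUnitalNonAssocRing B] [Module ℂ B] : Prop :=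
  ∃ f : A ≃ₗ[ℂ] B, ∀ x y : A, f (x * y) = f x * f y

end Notions

/-- The basis vectors `e 1, …, e 6` of `ℂ⁶`. -/
def e (k : ℕ) : Fin 6 → ℂ := fun i => if (i : ℕ) + 1 = k then 1 else 0

/-- A multiplication table: `T i j` is the product of the `i`-th and the `j`-th basis vector,
for `1 ≤ i, j ≤ 6` (the other values are never used). -/
abbrev Table : Type := ℕ → ℕ → (Fin 6 → ℂ)

/-- The complex algebra with underlying space `ℂ⁶` and multiplication table `T`. -/
def TableAlgebra (_T : Table) : Type := Fin 6 → ℂ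

namespace TableAlgebra

variable (T : Table)

instance : AddCommGroup (TableAlgebra T) := inferInstanceAs (AddCommGroup (Fin 6 → ℂ))

instance : Module ℂ (TableAlgebra T) := inferInstanceAs (Module ℂ (Fin 6 → ℂ))

/-- The bilinear extension of the multiplication table. -/
def mulVec (x y : Fin 6 → ℂ) : Fin 6 → ℂ :=
  ∑ i : Fin 6, ∑ j : Fin 6, (x i * y j) • T ((i : ℕ) + 1) ((j : ℕ) + 1)

instance : Mul (TableAlgebra T) := ⟨fun x y => mulVec T x y⟩

instance : NonUnitalNonAssocRing (TableAlgebra T) :=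
  { (inferInstance : AddCommGroup (TableAlgebra T)),
    (inferInstance : Mul (TableAlgebra T)) with
    left_distrib := fun x y z => by
      change mulVec T x (fun i => y i + z i) = mulVec T x y + mulVec T x z
      simp only [mulVec, mul_add, add_smul, Finset.sum_add_distrib]
    right_distrib := fun x y z => by
      change mulVec T (fun i => x i + y i) z = mulVec T x z + mulVec T y z
      simp only [mulVec, add_mul, add_smul, Finset.sum_add_distrib]
    zero_mul := fun x => by
      change mulVec T (fun _ => 0) x = 0
      simp [mulVec]
    mul_zero := fun x => by
      change mulVec T x (fun _ => 0) = 0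
      simp [mulVec] }

instance : IsScalarTower ℂ (TableAlgebra T) (TableAlgebra T) := ⟨fun c x y => by
  change mulVec T (fun i => c * x i) y = c • mulVec T x y
  simp only [mulVec, Finset.smul_sum, smul_smul, mul_assoc]⟩

instance : SMulCommClass ℂ (TableAlgebra T) (TableAlgebra T) := ⟨fun c x y => by
  change c • mulVec T x y = mulVec T x (fun i => c * y i)
  simp only [mulVec, Finset.smul_sum, smul_smul, mul_left_comm]⟩

end TableAlgebra

/-! The multiplication tables of the list; products that are not shown are zero. -/

noncomputable def B01 : Table
  | 1, 1 => e 2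
  | 1, 2 => e 4
  | 1, 4 => e 5
  | 2, 1 => e 3
  | 3, 1 => e 6
  | _, _ => 0

noncomputable def B02 (l : ℂ) : Table
  | 1, 1 => e 2
  | 1, 2 => e 4
  | 1, 3 => e 6
  | 1, 4 => e 5
  | 2, 1 => e 3
  | 2, 2 => e 6
  | 3, 1 => l • e 6
  | 4, 1 => e 6
  | _, _ => 0

noncomputable def B03 (l m : ℂ) : Table
  | 1, 1 => e 2
  | 1, 2 => e 4
  | 1, 3 => e 6
  | 1, 4 => l • e 5 + m • e 6
  | 2, 1 => e 3
  | 2, 2 => e 6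
  | 3, 1 => e 5
  | 4, 1 => e 6
  | _, _ => 0

noncomputable def B04 : Table
  | 1, 1 => e 2
  | 1, 2 => e 4
  | 1, 3 => e 6
  | 2, 1 => e 3
  | 2, 2 => e 6
  | 3, 1 => e 4 + e 5
  | 4, 1 => e 6
  | _, _ => 0

noncomputable def B05 : Table
  | 1, 1 => e 2
  | 1, 2 => e 5
  | 2, 1 => e 3
  | 3, 1 => e 4
  | 4, 1 => e 6
  | _, _ => 0

noncomputable def B06 : Table
  | 1, 1 => e 2
  | 1, 2 => e 3
  | 1, 3 => e 4
  | 1, 4 => e 6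
  | 2, 1 => e 4 + e 5
  | 2, 2 => e 6
  | 3, 1 => e 6
  | _, _ => 0

noncomputable def B07 : Table
  | 1, 1 => e 2
  | 1, 2 => e 3
  | 1, 3 => e 4
  | 1, 4 => e 6
  | 2, 1 => e 3 + e 4 + e 5
  | 2, 2 => e 4 + e 6
  | 2, 3 => e 6
  | 3, 1 => e 4 + e 6
  | 3, 2 => e 6
  | 4, 1 => e 6
  | _, _ => 0

noncomputable def B08 (l : ℂ) : Table
  | 1, 1 => e 2
  | 1, 2 => e 3
  | 1, 3 => e 4
  | 1, 4 => e 6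
  | 2, 1 => l • e 3 + e 5
  | 2, 2 => l • e 4
  | 2, 3 => l • e 6
  | 3, 1 => l • e 4
  | 3, 2 => l • e 6
  | 4, 1 => l • e 6
  | _, _ => 0

noncomputable def B09 (l : ℂ) : Table
  | 1, 1 => e 2
  | 1, 2 => e 4
  | 1, 3 => e 6
  | 1, 4 => l • e 6
  | 2, 1 => e 3
  | 2, 2 => e 6
  | 3, 1 => e 5
  | 4, 1 => e 6
  | 5, 1 => e 6
  | _, _ => 0

noncomputable def B10 : Table
  | 1, 1 => e 2
  | 1, 2 => e 4
  | 1, 4 => e 6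
  | 2, 1 => e 3
  | 3, 1 => e 5
  | 5, 1 => e 6
  | _, _ => 0

noncomputable def B11 : Table
  | 1, 1 => e 2
  | 1, 2 => e 4
  | 2, 1 => e 3
  | 3, 1 => e 5
  | 5, 1 => e 6
  | _, _ => 0

noncomputable def B12 (l : ℂ) : Table
  | 1, 1 => e 2
  | 1, 2 => e 3
  | 1, 3 => e 5
  | 1, 5 => e 6
  | 2, 1 => l • e 3 + e 4
  | 2, 2 => l • e 5
  | 2, 3 => l • e 6
  | 3, 1 => l • e 5
  | 3, 2 => l • e 6
  | 5, 1 => l • e 6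
  | _, _ => 0

noncomputable def B13 (l : ℂ) : Table
  | 1, 1 => e 2
  | 1, 2 => e 3
  | 1, 3 => e 5
  | 1, 5 => e 6
  | 2, 1 => l • e 3 + e 4
  | 2, 2 => l • e 5
  | 2, 3 => l • e 6
  | 3, 1 => l • e 5
  | 3, 2 => l • e 6
  | 4, 1 => e 6
  | 5, 1 => l • e 6
  | _, _ => 0

noncomputable def B14 (l : ℂ) : Table
  | 1, 1 => e 2
  | 1, 2 => e 3
  | 1, 3 => e 5
  | 1, 4 => e 6
  | 1, 5 => e 6
  | 2, 1 => e 4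
  | 2, 2 => e 6
  | 3, 1 => e 6
  | 4, 1 => l • e 6
  | _, _ => 0

noncomputable def B15 (l : ℂ) : Table
  | 1, 1 => e 2
  | 1, 2 => e 3
  | 1, 3 => e 5
  | 1, 4 => e 6
  | 1, 5 => e 6
  | 2, 1 => e 3 + e 4
  | 2, 2 => e 5 + e 6
  | 2, 3 => e 6
  | 3, 1 => e 5 + e 6
  | 3, 2 => e 6
  | 4, 1 => l • e 6
  | 5, 1 => e 6
  | _, _ => 0

noncomputable def B16 (l : ℂ) : Table
  | 1, 1 => e 2
  | 1, 2 => e 4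
  | 1, 3 => e 5
  | 1, 4 => l • e 5
  | 1, 5 => l • e 6
  | 2, 1 => e 3
  | 2, 2 => e 5
  | 2, 3 => e 6
  | 2, 4 => l • e 6
  | 3, 1 => (1 / l) • e 5
  | 3, 2 => e 6
  | 4, 1 => e 5
  | 4, 2 => l • e 6
  | 5, 1 => e 6
  | _, _ => 0

noncomputable def B17 (l : ℂ) : Table
  | 1, 1 => e 2
  | 1, 2 => e 4
  | 1, 3 => e 5
  | 1, 4 => l • e 5 + e 6
  | 1, 5 => l • e 6
  | 2, 1 => e 3
  | 2, 2 => e 5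
  | 2, 3 => e 6
  | 2, 4 => l • e 6
  | 3, 1 => (1 / l) • e 5
  | 3, 2 => e 6
  | 4, 1 => e 5
  | 4, 2 => l • e 6
  | 5, 1 => e 6
  | _, _ => 0

noncomputable def B18 (l : ℂ) : Table
  | 1, 1 => e 2
  | 1, 2 => e 4
  | 1, 3 => e 5
  | 1, 4 => e 5 + l • e 6
  | 1, 5 => e 6
  | 2, 1 => e 3
  | 2, 2 => e 5
  | 2, 3 => e 6
  | 2, 4 => e 6
  | 3, 1 => e 5 + e 6
  | 3, 2 => e 6
  | 4, 1 => e 5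
  | 4, 2 => e 6
  | 5, 1 => e 6
  | _, _ => 0

noncomputable def B19 : Table
  | 1, 1 => e 2
  | 1, 2 => e 4
  | 1, 3 => e 5
  | 1, 4 => e 6
  | 2, 1 => e 3
  | 2, 2 => e 5
  | 2, 3 => e 6
  | 3, 1 => e 4
  | 3, 2 => e 6
  | 4, 1 => e 5
  | 5, 1 => e 6
  | _, _ => 0

noncomputable def B20 : Table
  | 1, 1 => e 2
  | 1, 2 => e 5
  | 1, 3 => e 6
  | 2, 1 => e 3
  | 2, 2 => e 6
  | 3, 1 => e 4
  | 4, 1 => e 5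
  | 5, 1 => e 6
  | _, _ => 0

noncomputable def B21 : Table
  | 1, 1 => e 2
  | 1, 2 => e 6
  | 2, 1 => e 3
  | 3, 1 => e 4
  | 4, 1 => e 5
  | 5, 1 => e 6
  | _, _ => 0

noncomputable def B22 : Table
  | 1, 1 => e 2
  | 2, 1 => e 3
  | 3, 1 => e 4
  | 4, 1 => e 5
  | 5, 1 => e 6
  | _, _ => 0

noncomputable def B23 : Table
  | 1, 1 => e 2
  | 1, 2 => e 3
  | 1, 3 => e 4
  | 1, 4 => e 5
  | 1, 5 => e 6
  | 2, 1 => e 4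
  | 2, 2 => e 5
  | 2, 3 => e 6
  | 3, 1 => e 5
  | 3, 2 => e 6
  | 4, 1 => e 6
  | _, _ => 0

noncomputable def B24 : Table
  | 1, 1 => e 2
  | 1, 2 => e 3
  | 1, 3 => e 4
  | 1, 4 => e 5
  | 1, 5 => e 6
  | 2, 1 => e 3 + e 4
  | 2, 2 => e 4 + e 5
  | 2, 3 => e 5 + e 6
  | 2, 4 => e 6
  | 3, 1 => e 4 + e 5
  | 3, 2 => e 5 + e 6
  | 3, 3 => e 6
  | 4, 1 => e 5 + e 6
  | 4, 2 => e 6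
  | 5, 1 => e 6
  | _, _ => 0

noncomputable def B25 (l : ℂ) : Table
  | 1, 1 => e 2
  | 1, 2 => e 3
  | 1, 3 => e 4
  | 1, 4 => e 5
  | 1, 5 => e 6
  | 2, 1 => l • e 3
  | 2, 2 => l • e 4
  | 2, 3 => l • e 5
  | 2, 4 => l • e 6
  | 3, 1 => l • e 4
  | 3, 2 => l • e 5
  | 3, 3 => l • e 6
  | 4, 1 => l • e 5
  | 4, 2 => l • e 6
  | 5, 1 => l • e 6
  | _, _ => 0

noncomputable def B26 : Table
  | 1, 1 => e 2
  | 1, 2 => e 3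
  | 1, 3 => e 4
  | 1, 4 => e 5
  | 1, 5 => e 6
  | 2, 1 => e 6
  | _, _ => 0

noncomputable def B27 : Table
  | 1, 1 => e 2
  | 1, 2 => e 3
  | 1, 3 => e 4
  | 1, 4 => e 5
  | 1, 5 => e 6
  | 2, 1 => e 3 + e 6
  | 2, 2 => e 4
  | 2, 3 => e 5
  | 2, 4 => e 6
  | 3, 1 => e 4
  | 3, 2 => e 5
  | 3, 3 => e 6
  | 4, 1 => e 5
  | 4, 2 => e 6
  | 5, 1 => e 6
  | _, _ => 0

noncomputable def B28 : Table
  | 1, 1 => e 2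
  | 1, 2 => e 3
  | 1, 3 => e 4
  | 1, 4 => e 5
  | 1, 5 => e 6
  | 2, 1 => e 5
  | 2, 2 => e 6
  | 3, 1 => e 6
  | _, _ => 0

noncomputable def B29 : Table
  | 1, 1 => e 2
  | 1, 2 => e 3
  | 1, 3 => e 4
  | 1, 4 => e 5
  | 1, 5 => e 6
  | 2, 1 => e 3 + e 5
  | 2, 2 => e 4 + e 6
  | 2, 3 => e 5
  | 2, 4 => e 6
  | 3, 1 => e 4 + e 6
  | 3, 2 => e 5
  | 3, 3 => e 6
  | 4, 1 => e 5
  | 4, 2 => e 6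
  | 5, 1 => e 6
  | _, _ => 0

/-- The tables of the list, for all admissible values of the parameters. -/
inductive IsListed : Table → Prop
  | b01 : IsListed B01
  | b02 (l : ℂ) : IsListed (B02 l)
  | b03 (l m : ℂ) : IsListed (B03 l m)
  | b04 : IsListed B04
  | b05 : IsListed B05
  | b06 : IsListed B06
  | b07 : IsListed B07
  | b08 (l : ℂ) : IsListed (B08 l)
  | b09 (l : ℂ) : IsListed (B09 l)
  | b10 : IsListed B10
  | b11 : IsListed B11
  | b12 (l : ℂ) : IsListed (B12 l)
  | b13 (l : ℂ) : IsListed (B13 l)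
  | b14 (l : ℂ) : IsListed (B14 l)
  | b15 (l : ℂ) : IsListed (B15 l)
  | b16 (l : ℂ) (hl : l ≠ 0) : IsListed (B16 l)
  | b17 (l : ℂ) (hl : l ≠ 0) : IsListed (B17 l)
  | b18 (l : ℂ) : IsListed (B18 l)
  | b19 : IsListed B19
  | b20 : IsListed B20
  | b21 : IsListed B21
  | b22 : IsListed B22
  | b23 : IsListed B23
  | b24 : IsListed B24
  | b25 (l : ℂ) : IsListed (B25 l)
  | b26 : IsListed B26
  | b27 : IsListed B27
  | b28 : IsListed B28
  | b29 : IsListed B29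

end Bicomm

/-! Let `a` generate `A`. Bicommutativity makes the left and right multiplications by `a`,
restricted to the span of products, commute with each other. They generate a commutative algebra `Q`
of operators, and the square is a faithful cyclic `Q`-module with generator `a * a`, hence a copy of
`Q`. Thus `A = ℂ a ⊕ Q` with `a * a = 1`, `a * q = l q`, `q * a = r q` and `p * q = l r p q`: the
whole structure is the pair `l, r` of nilpotent elements generating the maximal ideal of a local
algebra `Q` of dimension at most five (`exists_hasModel`).

The generator is not unique. Passing from `a` to `c a + p` with `c ≠ 0` replaces `l` by `l (c + r
p)` and `r` by `r (c + l p)` (`HasModel.change`). The problem becomes that of normalising the pair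
`l, r` under these moves.

Let `I = (l, r)`. If `l` and `r` are dependent modulo `I ^ 2`, one of them generates `I`, the other
is a power series in it truncated at degree four, and a change of generator turns that series into a
monomial, a scalar multiple, or `l + l ^ k`. If they are independent, then `dim I ^ 2 ≤ 2`. When `I
^ 3 = 0`, a single quadratic relation describes the algebra. When `I ^ 3 ≠ 0`, associativity forces
`l ^ 2, l r, r ^ 2` modulo `I ^ 3` to be proportional to the squares and the product of two scalars,
which leaves a few constants to normalise.

To recognise a table it suffices to check its relations: the vectors it names then span `A`, and
`dim A = 6` makes them a basis (`HasModel.isomorphic`). The tables `B04` to `B08` and `B16` to `B18`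
are never reached; the other entries already cover all cases. -/

namespace Bicomm

/-! ### Algebras presented by a pair `l, r`: change of generator and comparison with tables. -/

section Presentation

variable {A : Type*} [NonUnitalNonAssocRing A] [Module ℂ A]

/-- `A` is the sum of `ℂ a` and of the image of the commutative local algebra `Q` under `ι`, and
the multiplication of `A` is given in terms of the elements `l` and `r` of `Q`, which describe the
left and the right multiplication by `a`. -/
structure Presents {Q : Type*} [CommRing Q] [Algebra ℂ Q] (a : A) (ι : Q →ₗ[ℂ] A) (l r : Q) :
    Prop where
  exists_add : ∀ x : A, ∃ (c : ℂ) (q : Q), x = c • a + ι q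
  mul_self : a * a = ι 1
  left_mul : ∀ q, a * ι q = ι (l * q)
  right_mul : ∀ q, ι q * a = ι (r * q)
  mul_mul : ∀ p q, ι p * ι q = ι (l * r * (p * q))
  nilpotent_left : IsNilpotent l
  nilpotent_right : IsNilpotent r
  residue : ∀ q : Q, ∃ (s : ℂ) (x y : Q), q = algebraMap ℂ Q s + l * x + r * y

variable (A) in
/-- `l` and `r` describe the multiplications by some generator of `A`. -/
def HasModel {Q : Type*} [CommRing Q] [Algebra ℂ Q] (l r : Q) : Prop :=
  ∃ (a : A) (ι : Q →ₗ[ℂ] A), Presents a ι l r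

theorem isNilpotent_span_pair {Q : Type*} [CommRing Q] {l r : Q} (hl : IsNilpotent l)
    (hr : IsNilpotent r) : IsNilpotent (Ideal.span {l, r}) := by
  rw [Ideal.FG.isNilpotent_iff_le_nilradical (Submodule.fg_span (by simp)), Ideal.span_le]
  rintro x (rfl | rfl)
  · exact hl
  · exact hr

/-- A subspace that contains `1` and is stable under `l` and `r` is everything. -/
theorem eq_top_of_stable {Q : Type*} [CommRing Q] [Algebra ℂ Q] {l r : Q}
    (hl : IsNilpotent l) (hr : IsNilpotent r)
    (hres : ∀ q : Q, ∃ (s : ℂ) (x y : Q), q = algebraMap ℂ Q s + l * x + r * y)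
    (V : Submodule ℂ Q) (h1 : (1 : Q) ∈ V) (hVl : ∀ q ∈ V, l * q ∈ V)
    (hVr : ∀ q ∈ V, r * q ∈ V) (q : Q) : q ∈ V := by
  obtain ⟨n, hn⟩ := isNilpotent_span_pair hl hr
  -- Successive approximation: `V` is dense for the `(l, r)`-adic filtration, which is finite
  -- because the ideal is nilpotent.
  have key : ∀ k : ℕ, ∀ q : Q, ∃ v ∈ V, q - v ∈ Ideal.span {l, r} ^ k := by
    intro k
    induction k with
    | zero => exact fun q => ⟨0, V.zero_mem, by simp⟩
    | succ k ih =>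
      intro q
      obtain ⟨s, x, y, rfl⟩ := hres q
      obtain ⟨v, hv, hxv⟩ := ih x
      obtain ⟨w, hw, hyw⟩ := ih y
      refine ⟨algebraMap ℂ Q s + l * v + r * w, V.add_mem (V.add_mem ?_ (hVl v hv)) (hVr w hw), ?_⟩
      · rw [Algebra.algebraMap_eq_smul_one]
        exact V.smul_mem s h1
      · rw [pow_succ']
        have e1 : l * (x - v) ∈ Ideal.span {l, r} * Ideal.span {l, r} ^ k :=
          Ideal.mul_mem_mul (Ideal.subset_span (by simp)) hxv
        have e2 : r * (y - w) ∈ Ideal.span {l, r} * Ideal.span {l, r} ^ k :=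
          Ideal.mul_mem_mul (Ideal.subset_span (by simp)) hyw
        convert add_mem e1 e2 using 1
        ring
  obtain ⟨v, hv, h⟩ := key n q
  rw [hn] at h
  have : q = v := sub_eq_zero.mp (by simpa using h)
  exact this ▸ hv

theorem isUnit_algebraMap_add {Q : Type*} [CommRing Q] [Algebra ℂ Q] {c : ℂ} (hc : c ≠ 0)
    {x : Q} (hx : IsNilpotent x) : IsUnit (algebraMap ℂ Q c + x) := by
  rw [add_comm]
  exact hx.isUnit_add_right_of_commute ((isUnit_iff_ne_zero.mpr hc).map (algebraMap ℂ Q))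
    (Commute.all _ _)

/-- Replacing the generator `a` by `c a + ι p`. -/
theorem HasModel.change [IsScalarTower ℂ A A] [SMulCommClass ℂ A A]
    {Q : Type*} [CommRing Q] [Algebra ℂ Q] {l r : Q} (h : HasModel A l r)
    {c : ℂ} (hc : c ≠ 0) (p : Q) :
    HasModel A (l * (algebraMap ℂ Q c + r * p)) (r * (algebraMap ℂ Q c + l * p)) := by
  obtain ⟨a, ι, h⟩ := h
  have hlu : IsUnit (algebraMap ℂ Q c + l * p) :=
    isUnit_algebraMap_add hc ((Commute.all _ _).isNilpotent_mul_right h.nilpotent_left)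
  have hru : IsUnit (algebraMap ℂ Q c + r * p) :=
    isUnit_algebraMap_add hc ((Commute.all _ _).isNilpotent_mul_right h.nilpotent_right)
  obtain ⟨ul, hul⟩ := hlu.exists_right_inv
  obtain ⟨ur, hur⟩ := hru.exists_right_inv
  have hsm : ∀ q : Q, c • ι q = ι (algebraMap ℂ Q c * q) := fun q => by
    rw [← map_smul, Algebra.smul_def]
  -- The square of `c a + ι p` is `ι ((c + l p) (c + r p))`, so the new copy of `Q` must send `1`
  -- there. This factor is a unit, hence the range of `ι` is unchanged.
  refine ⟨c • a + ι p, ι ∘ₗ LinearMap.mulLeft ℂ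
    ((algebraMap ℂ Q c + l * p) * (algebraMap ℂ Q c + r * p)), ?_, ?_, ?_, ?_, ?_, ?_, ?_, ?_⟩
  · intro x
    obtain ⟨d, q, rfl⟩ := h.exists_add x
    refine ⟨d / c, ul * ur * (q - (d / c) • p), ?_⟩
    have : (algebraMap ℂ Q c + l * p) * (algebraMap ℂ Q c + r * p) *
        (ul * ur * (q - (d / c) • p)) = q - (d / c) • p := by
      linear_combination (q - (d / c) • p) * (hul + (algebraMap ℂ Q c + l * p) * ul * hur)
    rw [LinearMap.comp_apply, LinearMap.mulLeft_apply, this, map_sub, map_smul, smul_add, smul_smul,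
      div_mul_cancel₀ _ hc]
    abel
  · simp only [LinearMap.comp_apply, LinearMap.mulLeft_apply, add_mul, mul_add, smul_mul_assoc,
      mul_smul_comm, h.mul_self, h.left_mul, h.right_mul, h.mul_mul, hsm, ← map_add]
    congr 1; ring
  · intro q
    simp only [LinearMap.comp_apply, LinearMap.mulLeft_apply, add_mul,  smul_mul_assoc,
      h.left_mul, h.mul_mul, hsm, ← map_add]
    congr 1; ring
  · intro q
    simp only [LinearMap.comp_apply, LinearMap.mulLeft_apply, mul_add,
      mul_smul_comm, h.right_mul, h.mul_mul, hsm, ← map_add]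
    congr 1; ring
  · intro q q'
    simp only [LinearMap.comp_apply, LinearMap.mulLeft_apply, h.mul_mul]
    congr 1; ring
  · exact (Commute.all _ _).isNilpotent_mul_right h.nilpotent_left
  · exact (Commute.all _ _).isNilpotent_mul_right h.nilpotent_right
  · intro q
    obtain ⟨s, x, y, rfl⟩ := h.residue q
    -- The inverses are crossed because the new `l` carries the factor `c + r p` and the new `r` the
    -- factor `c + l p`.
    refine ⟨s, ur * x, ul * y, ?_⟩
    linear_combination -l * x * hur - r * y * hul

/-- The products that the vectors `a, ι (q 1), …, ι (q 5)` have in an algebra presented by `l`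
and `r`. -/
def modelProduct {Q : Type*} [CommRing Q] (l r : Q) (q : Fin 6 → Q) (i j : Fin 6) : Q :=
  if i = 0 then (if j = 0 then 1 else l * q j) else (if j = 0 then r * q i else l * r * (q i * q j))

/-- An algebra presented by `l` and `r` is given by a table with matching products. -/
theorem HasModel.isomorphic [IsScalarTower ℂ A A] [SMulCommClass ℂ A A]
    (hdim : Module.finrank ℂ A = 6)
    {Q : Type*} [CommRing Q] [Algebra ℂ Q] {l r : Q} (h : HasModel A l r) (T : Table)
    (q : Fin 6 → Q) (hq : q 0 = 0)
    (hT : ∀ i j : Fin 6, T ((i : ℕ) + 1) ((j : ℕ) + 1) 0 = 0 ∧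
      ∑ k, T ((i : ℕ) + 1) ((j : ℕ) + 1) k • q k = modelProduct l r q i j) :
    Isomorphic A (TableAlgebra T) := by
  obtain ⟨a, ι, h⟩ := h
  have : FiniteDimensional ℂ A := FiniteDimensional.of_finrank_pos (by omega)
  let v : Fin 6 → A := fun i => if i = 0 then a else ι (q i)
  have hv : ∀ i j, v i * v j = ι (modelProduct l r q i j) := by
    intro i j
    by_cases hi : i = 0 <;> by_cases hj : j = 0 <;>
      simp [v, modelProduct, hi, hj, h.mul_self, h.left_mul, h.right_mul, h.mul_mul]
  let g : (Fin 6 → ℂ) →ₗ[ℂ] A := Fintype.linearCombination ℂ v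
  have hg : ∀ x, g x = ∑ i, x i • v i := fun x => Fintype.linearCombination_apply ℂ v x
  have hg0 : ∀ x : Fin 6 → ℂ, x 0 = 0 → g x = ι (∑ k, x k • q k) := by
    intro x hx
    rw [hg, map_sum]
    refine Finset.sum_congr rfl fun i _ => ?_
    by_cases hi : i = 0
    · simp [hi, hx]
    · simp [v, hi]
  have hmul : ∀ x y, g (TableAlgebra.mulVec T x y) = g x * g y := by
    intro x y
    rw [hg x, hg y, Finset.sum_mul_sum, TableAlgebra.mulVec, map_sum]
    refine Finset.sum_congr rfl fun i _ => ?_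
    rw [map_sum]
    refine Finset.sum_congr rfl fun j _ => ?_
    rw [map_smul, hg0 _ (hT i j).1, (hT i j).2, smul_mul_smul_comm, hv]
  have hV : ∀ p, p ∈ Submodule.span ℂ (Set.range q) := by
    have hmem : ∀ i j, modelProduct l r q i j ∈ Submodule.span ℂ (Set.range q) := fun i j => by
      rw [← (hT i j).2]
      exact Submodule.sum_mem _ fun k _ => Submodule.smul_mem _ _ (Submodule.subset_span ⟨k, rfl⟩)
    refine eq_top_of_stable h.nilpotent_left h.nilpotent_right h.residue _ (hmem 0 0) ?_ ?_
    · intro p hp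
      induction hp using Submodule.span_induction with
      | mem x hx =>
        obtain ⟨j, rfl⟩ := hx
        by_cases hj : j = 0
        · simp [hj, hq]
        · simpa [modelProduct, hj] using hmem 0 j
      | zero => simp
      | add x y _ _ hx hy => rw [mul_add]; exact add_mem hx hy
      | smul c x _ hx => rw [mul_smul_comm]; exact Submodule.smul_mem _ _ hx
    · intro p hp
      induction hp using Submodule.span_induction with
      | mem x hx =>
        obtain ⟨j, rfl⟩ := hx
        by_cases hj : j = 0
        · simp [hj, hq]
        · simpa [modelProduct, hj] using hmem j 0
      | zero => simp
      | add x y _ _ hx hy => rw [mul_add]; exact add_mem hx hy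
      | smul c x _ hx => rw [mul_smul_comm]; exact Submodule.smul_mem _ _ hx
  have hsurj : LinearMap.range g = ⊤ := by
    have hvg : ∀ i, v i ∈ LinearMap.range g := fun i => by
      rw [Fintype.range_linearCombination]
      exact Submodule.subset_span ⟨i, rfl⟩
    have hιg : ∀ p, ι p ∈ LinearMap.range g := by
      intro p
      induction hV p using Submodule.span_induction with
      | mem x hx =>
        obtain ⟨j, rfl⟩ := hx
        by_cases hj : j = 0
        · simp [hj, hq]
        · simpa [v, hj] using hvg j
      | zero => simp
      | add x y _ _ hx hy => rw [map_add]; exact add_mem hx hy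
      | smul c x _ hx => rw [map_smul]; exact Submodule.smul_mem _ _ hx
    rw [eq_top_iff]
    intro x _
    obtain ⟨c, p, rfl⟩ := h.exists_add x
    exact add_mem (Submodule.smul_mem _ _ (by simpa [v] using hvg 0)) (hιg p)
  -- Independence of the six vectors is never checked by hand: a surjection between spaces of
  -- dimension six is injective.
  have hinj : Function.Injective g :=
    (LinearMap.injective_iff_surjective_of_finrank_eq_finrank (by simp [hdim])).mpr
      (LinearMap.range_eq_top.mp hsurj)
  let f : (Fin 6 → ℂ) ≃ₗ[ℂ] A := LinearEquiv.ofBijective g ⟨hinj, LinearMap.range_eq_top.mp hsurj⟩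
  refine ⟨(f.symm : A ≃ₗ[ℂ] (Fin 6 → ℂ)), fun x y => ?_⟩
  apply f.injective
  refine (f.apply_symm_apply _).trans ?_
  change x * y = g (TableAlgebra.mulVec T (f.symm x) (f.symm y))
  rw [hmul]
  exact congrArg₂ _ (f.apply_symm_apply x).symm (f.apply_symm_apply y).symm

end Presentation

/-! ### From a one-generated bicommutative nilpotent algebra to the pair `l, r`. -/

section Construction

universe u

variable {A : Type u} [NonUnitalNonAssocRing A] [Module ℂ A]

variable (A) in
/-- The span of the products. -/
def square : Submodule ℂ A := Submodule.span ℂ {x | ∃ y z : A, x = y * z}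

theorem mul_mem_square (x y : A) : x * y ∈ square A := Submodule.subset_span ⟨x, y, rfl⟩

variable [IsScalarTower ℂ A A] [SMulCommClass ℂ A A]

/-- Elements of the square commute with each other. -/
theorem IsBicommutative.mul_comm_of_mem (h : IsBicommutative A) {u v : A} (hu : u ∈ square A)
    (hv : v ∈ square A) : u * v = v * u := by
  induction hu, hv using Submodule.span_induction₂ with
  | mem_mem u v hu hv =>
    obtain ⟨x, y, rfl⟩ := hu
    obtain ⟨z, w, rfl⟩ := hv
    -- In a product of two products the right entries can be exchanged, and likewise (`h2`) the left
    -- entries. Doing both exchanges the two factors.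
    have h1 : ∀ x y z w : A, (x * y) * (z * w) = (x * w) * (z * y) := fun x y z w => by
      rw [h.2 (x * y) z w, h.1 x y w, h.2 z (x * w) y]
    have h2 : ∀ x y z w : A, (x * y) * (z * w) = (z * y) * (x * w) := fun x y z w => by
      rw [h.1 x y (z * w), h.2 x z w, h.1 z (x * w) y]
    rw [h2, h1]
  | zero_left => simp
  | zero_right => simp
  | add_left x y z _ _ _ hx hy => rw [add_mul, mul_add, hx, hy]
  | add_right x y z _ _ _ hx hy => rw [add_mul, mul_add, hx, hy]
  | smul_left c x y _ _ hx => rw [smul_mul_assoc, mul_smul_comm, hx]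
  | smul_right c x y _ _ hx => rw [smul_mul_assoc, mul_smul_comm, hx]

/-- On the square, the left and right multiplications commute. -/
theorem IsBicommutative.mul_assoc_of_mem (h : IsBicommutative A) (x y : A) {u : A}
    (hu : u ∈ square A) : x * (u * y) = (x * u) * y := by
  induction hu using Submodule.span_induction with
  | mem u hu =>
    obtain ⟨a, b, rfl⟩ := hu
    -- Both sides become the product of `x * b` and `a * y`, in opposite orders.
    rw [h.2 x (a * b) y, h.1 a b (x * y), h.2 a x y, h.1 x (a * y) b, h.2 x a b, h.1 a (x * b) y,
      h.mul_comm_of_mem (mul_mem_square _ _) (mul_mem_square _ _)]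
  | zero => simp
  | add x y _ _ hx hy => rw [add_mul, mul_add, mul_add, add_mul, hx, hy]
  | smul c x _ hx => rw [smul_mul_assoc, mul_smul_comm, hx, mul_smul_comm, smul_mul_assoc]

/-- Left multiplication on the square. -/
def leftMul (a : A) : Module.End ℂ (square A) :=
  (LinearMap.mulLeft ℂ a).restrict fun _ _ => mul_mem_square _ _

/-- Right multiplication on the square. -/
def rightMul (a : A) : Module.End ℂ (square A) :=
  (LinearMap.mulRight ℂ a).restrict fun _ _ => mul_mem_square _ _

omit [IsScalarTower ℂ A A] in
@[simp] theorem coe_leftMul (a : A) (u : square A) : (leftMul a u : A) = a * u := rfl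

omit [IsScalarTower ℂ A A] in
theorem IsProduct.pow_leftMul (a : A) (k : ℕ) :
    IsProduct (k + 1) ((LinearMap.mulLeft ℂ a ^ k) a) := by
  induction k with
  | zero => exact .of a
  | succ k ih =>
    rw [pow_succ', Module.End.mul_apply, LinearMap.mulLeft_apply, add_comm]
    exact .mul (.of a) ih

omit [SMulCommClass ℂ A A] in
theorem IsProduct.pow_rightMul (a : A) (k : ℕ) :
    IsProduct (k + 1) ((LinearMap.mulRight ℂ a ^ k) a) := by
  induction k with
  | zero => exact .of a
  | succ k ih =>
    rw [pow_succ', Module.End.mul_apply, LinearMap.mulRight_apply]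
    exact .mul ih (.of a)

/-- `Q` is the algebra of operators generated by the two multiplications by a generator `a`, and `ι`
evaluates an operator at `a * a`. Evaluation is injective since `Q` is commutative and `a * a`
generates the square over `Q`. The bound five comes from `a` lying outside the range of `ι`. -/
theorem exists_hasModel (hdim : Module.finrank ℂ A = 6) (hb : IsBicommutative A)
    (hnil : IsNilpotentAlgebra A) (hgen : IsOneGenerated A) :
    ∃ (Q : Type u) (_ : CommRing Q) (_ : Algebra ℂ Q) (l r : Q), FiniteDimensional ℂ Q ∧
      Module.finrank ℂ Q ≤ 5 ∧ Nontrivial Q ∧ HasModel A l r := by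
  have hfd : FiniteDimensional ℂ A := FiniteDimensional.of_finrank_pos (by omega)
  obtain ⟨a, ha⟩ := hgen
  let s : Set (Module.End ℂ (square A)) := {leftMul a, rightMul a}
  have hLR : leftMul a * rightMul a = rightMul a * leftMul a := by
    ext u
    exact hb.mul_assoc_of_mem a a u.2
  have hcomm : ∀ x ∈ s, ∀ y ∈ s, x * y = y * x := by
    rintro x (rfl | rfl) y (rfl | rfl)
    · rfl
    · exact hLR
    · exact hLR.symm
    · rfl
  obtain ⟨Q, hQs⟩ : ∃ Q, Q = Algebra.adjoin ℂ s := ⟨_, rfl⟩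
  have hQcomm : IsMulCommutative Q := hQs ▸ Algebra.isMulCommutative_adjoin ℂ hcomm
  let _ : CommRing Q := { (inferInstance : Ring Q) with mul_comm := hQcomm.is_comm.comm }
  let l : Q := ⟨leftMul a, hQs ▸ Algebra.subset_adjoin (by simp [s])⟩
  let r : Q := ⟨rightMul a, hQs ▸ Algebra.subset_adjoin (by simp [s])⟩
  let w : square A := ⟨a * a, mul_mem_square a a⟩
  let ι : Q →ₗ[ℂ] A :=
    (square A).subtype ∘ₗ LinearMap.applyₗ w ∘ₗ Q.val.toLinearMap
  have hι : ∀ q : Q, ι q = ((q : Module.End ℂ (square A)) w : A) := fun q => rfl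
  -- Multiplication on the square is `Q`-linear in its first argument, so products of elements of
  -- the square are determined by products with `a * a`.
  have hact : ∀ f ∈ Q, ∀ u v : square A,
      (f u : A) * v = f ⟨u * v, mul_mem_square _ _⟩ := by
    intro f hf
    rw [hQs] at hf
    induction hf using Algebra.adjoin_induction with
    | mem f hf =>
      intro u v
      obtain rfl | rfl := hf
      · rw [coe_leftMul, coe_leftMul, hb.mul_comm_of_mem (mul_mem_square _ _) v.2, hb.2 v a u,
          hb.mul_comm_of_mem v.2 u.2]
      · exact hb.1 u a v
    | algebraMap c =>
      intro u v
      simp [Module.algebraMap_end_apply, smul_mul_assoc]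
    | add f g _ _ hf hg =>
      intro u v
      simp [add_mul, hf, hg]
    | mul f g _ _ hf hg =>
      intro u v
      rw [Module.End.mul_apply, Module.End.mul_apply, hf]
      congr 2
      exact Subtype.ext (hg u v)
  have hw : ∀ v : square A, (w : A) * v = leftMul a (rightMul a v) := by
    intro v
    rw [hb.mul_comm_of_mem w.2 v.2]
    exact hb.2 v a a
  have hself : a * a = ι 1 := rfl
  have hleft : ∀ q, a * ι q = ι (l * q) := fun q => rfl
  have hright : ∀ q, ι q * a = ι (r * q) := fun q => rfl
  have hmul : ∀ p q, ι p * ι q = ι (l * r * (p * q)) := by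
    intro p q
    have : l * r * (p * q) = p * (l * r * q) := by ring
    rw [this, hι, hι, hact p p.2]
    change _ = (((p : Module.End ℂ (square A))
      (leftMul a (rightMul a ((q : Module.End ℂ (square A)) w))) : square A) : A)
    congr 2
    exact Subtype.ext (hw _)
  have hadd : ∀ x : A, ∃ (c : ℂ) (q : Q), x = c • a + ι q := by
    intro x
    have hx : x ∈ NonUnitalAlgebra.adjoin ℂ {a} := ha ▸ NonUnitalAlgebra.mem_top
    induction hx using NonUnitalAlgebra.adjoin_induction with
    | mem x hx =>
      obtain rfl : x = a := hx
      exact ⟨1, 0, by simp⟩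
    | add x y _ _ hx hy =>
      obtain ⟨c, p, rfl⟩ := hx
      obtain ⟨d, q, rfl⟩ := hy
      exact ⟨c + d, p + q, by rw [map_add, add_smul]; abel⟩
    | zero => exact ⟨0, 0, by simp⟩
    | mul x y _ _ hx hy =>
      obtain ⟨c, p, rfl⟩ := hx
      obtain ⟨d, q, rfl⟩ := hy
      refine ⟨0, (c * d) • 1 + c • (l * q) + d • (r * p) + l * r * (p * q), ?_⟩
      simp only [add_mul, mul_add, smul_mul_assoc, mul_smul_comm, hself, hleft, hright, hmul,
        map_add, map_smul]
      module
    | smul c x _ hx =>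
      obtain ⟨d, q, rfl⟩ := hx
      exact ⟨c * d, c • q, by rw [map_smul, smul_add, smul_smul]⟩
  have hsquare : ∀ u ∈ square A, ∃ q, u = ι q := by
    intro u hu
    induction hu using Submodule.span_induction with
    | mem u hu =>
      obtain ⟨x, y, rfl⟩ := hu
      obtain ⟨c, p, rfl⟩ := hadd x
      obtain ⟨d, q, rfl⟩ := hadd y
      refine ⟨(c * d) • 1 + c • (l * q) + d • (r * p) + l * r * (p * q), ?_⟩
      simp only [add_mul, mul_add, smul_mul_assoc, mul_smul_comm, hself, hleft, hright, hmul,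
        map_add, map_smul]
      module
    | zero => exact ⟨0, by simp⟩
    | add x y _ _ hx hy =>
      obtain ⟨p, rfl⟩ := hx
      obtain ⟨q, rfl⟩ := hy
      exact ⟨p + q, by rw [map_add]⟩
    | smul c x _ hx =>
      obtain ⟨p, rfl⟩ := hx
      exact ⟨c • p, by rw [map_smul]⟩
  -- An operator in `Q` that kills the cyclic vector `w` kills every `p w`, by commutativity, and
  -- these exhaust the square.
  have hinj : ∀ q : Q, ι q = 0 → q = 0 := by
    intro q hq
    apply Subtype.ext
    ext u
    obtain ⟨p, hp⟩ := hsquare u u.2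
    have hu : u = (p : Module.End ℂ (square A)) w := Subtype.ext hp
    have hqw : (q : Module.End ℂ (square A)) w = 0 := Subtype.ext hq
    have hqp : (q : Module.End ℂ (square A)) * p = p * q :=
      congrArg Subtype.val (mul_comm q p)
    rw [hu, ← Module.End.mul_apply, hqp, Module.End.mul_apply, hqw]
    simp
  have hpow_left : ∀ k : ℕ, ι (l ^ k) = (LinearMap.mulLeft ℂ a ^ (k + 1)) a := by
    intro k
    induction k with
    | zero => simp [← hself]
    | succ k ih => rw [pow_succ', ← hleft, ih, pow_succ' _ (k + 1)]; rfl
  have hpow_right : ∀ k : ℕ, ι (r ^ k) = (LinearMap.mulRight ℂ a ^ (k + 1)) a := by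
    intro k
    induction k with
    | zero => simp [← hself]
    | succ k ih => rw [pow_succ', ← hright, ih, pow_succ' _ (k + 1)]; rfl
  obtain ⟨n, hn, hprod⟩ := hnil
  have hl : IsNilpotent l := by
    refine ⟨n, hinj _ ?_⟩
    have h0 : (LinearMap.mulLeft ℂ a ^ (n - 1)) a = 0 :=
      hprod _ (by simpa [Nat.sub_add_cancel hn] using IsProduct.pow_leftMul a (n - 1))
    -- `ι` shifts the exponent by one, as `ι 1 = a * a`. The exponent `n` is not sharp, but it also
    -- covers `n = 1`.
    rw [hpow_left, show n + 1 = 2 + (n - 1) by omega, pow_add, Module.End.mul_apply, h0, map_zero]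
  have hr : IsNilpotent r := by
    refine ⟨n, hinj _ ?_⟩
    have h0 : (LinearMap.mulRight ℂ a ^ (n - 1)) a = 0 :=
      hprod _ (by simpa [Nat.sub_add_cancel hn] using IsProduct.pow_rightMul a (n - 1))
    rw [hpow_right, show n + 1 = 2 + (n - 1) by omega, pow_add, Module.End.mul_apply, h0, map_zero]
  have hres : ∀ q : Q, ∃ (s : ℂ) (x y : Q), q = algebraMap ℂ Q s + l * x + r * y := by
    suffices h : ∀ f ∈ Algebra.adjoin ℂ s, ∀ hf : f ∈ Q, ∃ (s : ℂ) (x y : Q),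
        (⟨f, hf⟩ : Q) = algebraMap ℂ Q s + l * x + r * y from fun q => h q (hQs ▸ q.2) q.2
    intro f hf
    induction hf using Algebra.adjoin_induction with
    | mem f hf =>
      intro _
      obtain rfl | rfl := hf
      · exact ⟨0, 1, 0, by simp [l]⟩
      · exact ⟨0, 0, 1, by simp [r]⟩
    | algebraMap c => exact fun _ => ⟨c, 0, 0, by simp⟩
    | add f g hf' hg' hf hg =>
      intro _
      rw [← hQs] at hf' hg'
      obtain ⟨s, x, y, hf⟩ := hf hf'
      obtain ⟨t, x', y', hg⟩ := hg hg'
      refine ⟨s + t, x + x', y + y', ?_⟩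
      change (⟨f, hf'⟩ : Q) + ⟨g, hg'⟩ = _
      rw [hf, hg, map_add]
      ring
    | mul f g hf' hg' hf hg =>
      intro _
      rw [← hQs] at hf' hg'
      obtain ⟨s, x, y, hf⟩ := hf hf'
      obtain ⟨t, x', y', hg⟩ := hg hg'
      refine ⟨s * t, x * (algebraMap ℂ Q t + l * x' + r * y') + algebraMap ℂ Q s * x',
        y * (algebraMap ℂ Q t + l * x' + r * y') + algebraMap ℂ Q s * y', ?_⟩
      change (⟨f, hf'⟩ : Q) * ⟨g, hg'⟩ = _
      rw [hf, hg, map_mul]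
      ring
  have : Nontrivial A := Module.nontrivial_of_finrank_pos (R := ℂ) (by omega)
  have hι_inj : Function.Injective ι := (injective_iff_map_eq_zero ι).mpr hinj
  have hQ : Nontrivial Q := by
    by_contra hQ
    rw [not_nontrivial_iff_subsingleton] at hQ
    have hz : ∀ q, ι q = 0 := fun q => by rw [Subsingleton.elim q 0, map_zero]
    have : Module.finrank ℂ A ≤ 1 := finrank_le_one a fun x => by
      obtain ⟨c, q, rfl⟩ := hadd x
      exact ⟨c, by rw [hz, add_zero]⟩
    omega
  -- If `a = ι q`, then `a * a = ι (l r q ^ 2)` forces `l r q ^ 2 = 1`, so the nilpotent `l` would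
  -- be a unit.
  have ha_notMem : a ∉ LinearMap.range ι := by
    rintro ⟨q, hq⟩
    have h1 : ι (l * r * (q * q)) = ι 1 := by rw [← hmul, hq, hself]
    have h2 : l * (r * (q * q)) = 1 := by rw [← mul_assoc]; exact hι_inj h1
    exact not_isNilpotent_one
      (h2 ▸ (Commute.all l (r * (q * q))).isNilpotent_mul_right hl)
  refine ⟨Q, inferInstance, inferInstance, l, r, Module.Finite.of_injective ι hι_inj, ?_, hQ, a, ι,
    ⟨hadd, hself, hleft, hright, hmul, hl, hr, hres⟩⟩
  rw [← LinearMap.finrank_range_of_inj hι_inj]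
  have : Module.finrank ℂ (LinearMap.range ι) < Module.finrank ℂ A :=
    Submodule.finrank_lt fun h => ha_notMem (h ▸ Submodule.mem_top)
  omega

end Construction

/-! ### Reduction of an isomorphism with a table to 36 identities in `Q`. -/

section Tables

variable {A : Type*} [NonUnitalNonAssocRing A] [Module ℂ A] [IsScalarTower ℂ A A]
  [SMulCommClass ℂ A A] {Q : Type*} [CommRing Q] [Algebra ℂ Q]

/-- The vector `x` is a combination of `e 2, …, e 6`, and the same combination of `q 1, …, q 5` is
`y`. -/
def Represents (q : Fin 6 → Q) (x : Fin 6 → ℂ) (y : Q) : Prop := x 0 = 0 ∧ ∑ k, x k • q k = y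

namespace Represents

variable {q : Fin 6 → Q} {x x' : Fin 6 → ℂ} {y y' : Q}

theorem zero : Represents q 0 0 := by simp [Represents]

theorem basis (k : Fin 5) : Represents q (e (k + 2)) (q k.succ) := by
  constructor
  · simp [e]
  · rw [Finset.sum_eq_single k.succ]
    · simp [e]
    · intro i _ hi
      have : (i : ℕ) ≠ k + 1 := fun h => hi (Fin.ext h)
      simp [e, this]
    · simp

theorem add (h : Represents q x y) (h' : Represents q x' y') :
    Represents q (x + x') (y + y') := by
  refine ⟨by simp [h.1, h'.1], ?_⟩
  simp only [Pi.add_apply, add_smul, Finset.sum_add_distrib, h.2, h'.2]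

theorem smul (c : ℂ) (h : Represents q x y) : Represents q (c • x) (algebraMap ℂ Q c * y) := by
  refine ⟨by simp [h.1], ?_⟩
  rw [← h.2, ← Algebra.smul_def, Finset.smul_sum]
  exact Finset.sum_congr rfl fun i _ => mul_smul c (x i) (q i)

theorem congr (h : Represents q x y) (hy : y = y') : Represents q x y' := hy ▸ h

variable {x y z w : Q}

theorem e2 : Represents ![0, 1, x, y, z, w] (e 2) 1 := basis 0

theorem e3 : Represents ![0, 1, x, y, z, w] (e 3) x := basis 1

theorem e4 : Represents ![0, 1, x, y, z, w] (e 4) y := basis 2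

theorem e5 : Represents ![0, 1, x, y, z, w] (e 5) z := basis 3

theorem e6 : Represents ![0, 1, x, y, z, w] (e 6) w := basis 4

end Represents

/-- The products of basis vectors in the table are those of the vectors `a, ι 1, ι x, ι y, ι z,
ι w`. -/
theorem HasModel.isomorphic_of_represents {l r : Q} (h : HasModel A l r)
    (hdim : Module.finrank ℂ A = 6) (T : Table) (x y z w : Q)
    (h11 : Represents ![0, 1, x, y, z, w] (T 1 1) 1)
    (h12 : Represents ![0, 1, x, y, z, w] (T 1 2) l)
    (h13 : Represents ![0, 1, x, y, z, w] (T 1 3) (l * x))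
    (h14 : Represents ![0, 1, x, y, z, w] (T 1 4) (l * y))
    (h15 : Represents ![0, 1, x, y, z, w] (T 1 5) (l * z))
    (h16 : Represents ![0, 1, x, y, z, w] (T 1 6) (l * w))
    (h21 : Represents ![0, 1, x, y, z, w] (T 2 1) r)
    (h22 : Represents ![0, 1, x, y, z, w] (T 2 2) (l * r))
    (h23 : Represents ![0, 1, x, y, z, w] (T 2 3) (l * r * x))
    (h24 : Represents ![0, 1, x, y, z, w] (T 2 4) (l * r * y))
    (h25 : Represents ![0, 1, x, y, z, w] (T 2 5) (l * r * z))
    (h26 : Represents ![0, 1, x, y, z, w] (T 2 6) (l * r * w))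
    (h31 : Represents ![0, 1, x, y, z, w] (T 3 1) (r * x))
    (h32 : Represents ![0, 1, x, y, z, w] (T 3 2) (l * r * x))
    (h33 : Represents ![0, 1, x, y, z, w] (T 3 3) (l * r * (x * x)))
    (h34 : Represents ![0, 1, x, y, z, w] (T 3 4) (l * r * (x * y)))
    (h35 : Represents ![0, 1, x, y, z, w] (T 3 5) (l * r * (x * z)))
    (h36 : Represents ![0, 1, x, y, z, w] (T 3 6) (l * r * (x * w)))
    (h41 : Represents ![0, 1, x, y, z, w] (T 4 1) (r * y))
    (h42 : Represents ![0, 1, x, y, z, w] (T 4 2) (l * r * y))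
    (h43 : Represents ![0, 1, x, y, z, w] (T 4 3) (l * r * (y * x)))
    (h44 : Represents ![0, 1, x, y, z, w] (T 4 4) (l * r * (y * y)))
    (h45 : Represents ![0, 1, x, y, z, w] (T 4 5) (l * r * (y * z)))
    (h46 : Represents ![0, 1, x, y, z, w] (T 4 6) (l * r * (y * w)))
    (h51 : Represents ![0, 1, x, y, z, w] (T 5 1) (r * z))
    (h52 : Represents ![0, 1, x, y, z, w] (T 5 2) (l * r * z))
    (h53 : Represents ![0, 1, x, y, z, w] (T 5 3) (l * r * (z * x)))
    (h54 : Represents ![0, 1, x, y, z, w] (T 5 4) (l * r * (z * y)))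
    (h55 : Represents ![0, 1, x, y, z, w] (T 5 5) (l * r * (z * z)))
    (h56 : Represents ![0, 1, x, y, z, w] (T 5 6) (l * r * (z * w)))
    (h61 : Represents ![0, 1, x, y, z, w] (T 6 1) (r * w))
    (h62 : Represents ![0, 1, x, y, z, w] (T 6 2) (l * r * w))
    (h63 : Represents ![0, 1, x, y, z, w] (T 6 3) (l * r * (w * x)))
    (h64 : Represents ![0, 1, x, y, z, w] (T 6 4) (l * r * (w * y)))
    (h65 : Represents ![0, 1, x, y, z, w] (T 6 5) (l * r * (w * z)))
    (h66 : Represents ![0, 1, x, y, z, w] (T 6 6) (l * r * (w * w))) :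
    Isomorphic A (TableAlgebra T) := by
  refine h.isomorphic hdim T ![0, 1, x, y, z, w] rfl fun i j => ?_
  change Represents _ _ _
  fin_cases i <;> fin_cases j
  · exact h11.congr (by simp [modelProduct])
  · exact h12.congr (by simp [modelProduct])
  · exact h13.congr (by simp [modelProduct])
  · exact h14.congr (by simp [modelProduct])
  · exact h15.congr (by simp [modelProduct])
  · exact h16.congr (by simp [modelProduct])
  · exact h21.congr (by simp [modelProduct])
  · exact h22.congr (by simp [modelProduct])
  · exact h23.congr (by simp [modelProduct])
  · exact h24.congr (by simp [modelProduct])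
  · exact h25.congr (by simp [modelProduct])
  · exact h26.congr (by simp [modelProduct])
  · exact h31.congr (by simp [modelProduct])
  · exact h32.congr (by simp [modelProduct])
  · exact h33.congr (by simp [modelProduct])
  · exact h34.congr (by simp [modelProduct])
  · exact h35.congr (by simp [modelProduct])
  · exact h36.congr (by simp [modelProduct])
  · exact h41.congr (by simp [modelProduct])
  · exact h42.congr (by simp [modelProduct])
  · exact h43.congr (by simp [modelProduct])
  · exact h44.congr (by simp [modelProduct])
  · exact h45.congr (by simp [modelProduct])
  · exact h46.congr (by simp [modelProduct])
  · exact h51.congr (by simp [modelProduct])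
  · exact h52.congr (by simp [modelProduct])
  · exact h53.congr (by simp [modelProduct])
  · exact h54.congr (by simp [modelProduct])
  · exact h55.congr (by simp [modelProduct])
  · exact h56.congr (by simp [modelProduct])
  · exact h61.congr (by simp [modelProduct])
  · exact h62.congr (by simp [modelProduct])
  · exact h63.congr (by simp [modelProduct])
  · exact h64.congr (by simp [modelProduct])
  · exact h65.congr (by simp [modelProduct])
  · exact h66.congr (by simp [modelProduct])

end Tables

/-! ### The relations between `l` and `r` that characterise each table. -/

section Presentations

variable {A : Type*} [NonUnitalNonAssocRing A] [Module ℂ A] [IsScalarTower ℂ A A]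
  [SMulCommClass ℂ A A] {Q : Type*} [CommRing Q] [Algebra ℂ Q] {l r : Q}

/-- The four elements supplied here stand for `e 3` to `e 6`; `e 1` is the generator and `e 2` its
square. In each of the 36 goals the shape of the table entry first fixes the element of `Q` that it
represents. What remains is an identity in `Q` that follows from the relations. The other lemmas of
this part work in the same way. -/
theorem HasModel.isomorphic_B01 (h : HasModel A l r) (hdim : Module.finrank ℂ A = 6)
    (hlr : l * r = 0) (h1 : l ^ 3 = 0) (h2 : r ^ 3 = 0) :
    Isomorphic A (TableAlgebra B01) := by
  apply h.isomorphic_of_represents hdim B01 r l (l ^ 2) (r ^ 2) <;>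
    simp only [B01] <;>
    (apply Represents.congr
     · with_reducible repeat' first
        | exact .zero | exact .e2 | exact .e3 | exact .e4 | exact .e5 | exact .e6
     · grind)

theorem HasModel.isomorphic_B02 (h : HasModel A l r) (hdim : Module.finrank ℂ A = 6) (c : ℂ)
    (hr : r ^ 2 = algebraMap ℂ Q c * (l * r)) (h1 : l ^ 3 = 0) (h2 : l ^ 2 * r = 0)
    (h3 : l * r ^ 2 = 0) (h4 : r ^ 3 = 0) :
    Isomorphic A (TableAlgebra (B02 c)) := by
  apply h.isomorphic_of_represents hdim (B02 c) r l (l ^ 2) (l * r) <;>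
    simp only [B02] <;>
    (apply Represents.congr
     · with_reducible repeat' first
        | exact .zero | exact .e2 | exact .e3 | exact .e4 | exact .e5 | exact .e6
        | apply Represents.smul
     · grind)

theorem HasModel.isomorphic_B03 (h : HasModel A l r) (hdim : Module.finrank ℂ A = 6) (c d : ℂ)
    (hl : l ^ 2 = algebraMap ℂ Q c * r ^ 2 + algebraMap ℂ Q d * (l * r)) (h1 : l ^ 3 = 0)
    (h2 : l ^ 2 * r = 0) (h3 : l * r ^ 2 = 0) (h4 : r ^ 3 = 0) :
    Isomorphic A (TableAlgebra (B03 c d)) := by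
  apply h.isomorphic_of_represents hdim (B03 c d) r l (r ^ 2) (l * r) <;>
    simp only [B03] <;>
    (apply Represents.congr
     · with_reducible repeat' first
        | exact .zero | exact .e2 | exact .e3 | exact .e4 | exact .e5 | exact .e6
        | apply Represents.smul | apply Represents.add
     · grind)

theorem HasModel.isomorphic_B09 (h : HasModel A l r) (hdim : Module.finrank ℂ A = 6) (c : ℂ)
    (hl : l ^ 2 = algebraMap ℂ Q c * r ^ 3) (hlr : l * r = r ^ 3) (hr : r ^ 4 = 0) :
    Isomorphic A (TableAlgebra (B09 c)) := by
  apply h.isomorphic_of_represents hdim (B09 c) r l (r ^ 2) (r ^ 3) <;>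
    simp only [B09] <;>
    (apply Represents.congr
     · with_reducible repeat' first
        | exact .zero | exact .e2 | exact .e3 | exact .e4 | exact .e5 | exact .e6
        | apply Represents.smul
     · grind)

/-- Degree four vanishes by itself: `r ^ 4 = l ^ 2 r = 0`. -/
theorem HasModel.isomorphic_B10 (h : HasModel A l r) (hdim : Module.finrank ℂ A = 6)
    (hl : l ^ 2 = r ^ 3) (hlr : l * r = 0) :
    Isomorphic A (TableAlgebra B10) := by
  apply h.isomorphic_of_represents hdim B10 r l (r ^ 2) (r ^ 3) <;>
    simp only [B10] <;>
    (apply Represents.congr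
     · with_reducible repeat' first
        | exact .zero | exact .e2 | exact .e3 | exact .e4 | exact .e5 | exact .e6
     · grind)

theorem HasModel.isomorphic_B11 (h : HasModel A l r) (hdim : Module.finrank ℂ A = 6)
    (hl : l ^ 2 = 0) (hlr : l * r = 0) (hr : r ^ 4 = 0) :
    Isomorphic A (TableAlgebra B11) := by
  apply h.isomorphic_of_represents hdim B11 r l (r ^ 2) (r ^ 3) <;>
    simp only [B11] <;>
    (apply Represents.congr
     · with_reducible repeat' first
        | exact .zero | exact .e2 | exact .e3 | exact .e4 | exact .e5 | exact .e6
     · grind)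

/-- The entry `e 2 * e 1` must be `r`, so `e 4` is the difference `r - c l`, which annihilates both
`l` and `r`. -/
theorem HasModel.isomorphic_B12 (h : HasModel A l r) (hdim : Module.finrank ℂ A = 6) (c : ℂ)
    (hlr : l * r = algebraMap ℂ Q c * l ^ 2) (hr : r ^ 2 = algebraMap ℂ Q c * (l * r))
    (hl : l ^ 4 = 0) :
    Isomorphic A (TableAlgebra (B12 c)) := by
  apply h.isomorphic_of_represents hdim (B12 c) l (r - algebraMap ℂ Q c * l) (l ^ 2) (l ^ 3) <;>
    simp only [B12] <;>
    (apply Represents.congr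
     · with_reducible repeat' first
        | exact .zero | exact .e2 | exact .e3 | exact .e4 | exact .e5 | exact .e6
        | apply Represents.smul | apply Represents.add
     · grind)

/-- Computing `l r ^ 2` from each of the two relations gives `c ^ 2 l ^ 3` and `c ^ 2 l ^ 3 + l ^
4`, whence `l ^ 4 = 0`. -/
theorem HasModel.isomorphic_B13 (h : HasModel A l r) (hdim : Module.finrank ℂ A = 6) (c : ℂ)
    (hlr : l * r = algebraMap ℂ Q c * l ^ 2) (hr : r ^ 2 = algebraMap ℂ Q c * (l * r) + l ^ 3) :
    Isomorphic A (TableAlgebra (B13 c)) := by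
  apply h.isomorphic_of_represents hdim (B13 c) l (r - algebraMap ℂ Q c * l) (l ^ 2) (l ^ 3) <;>
    simp only [B13] <;>
    (apply Represents.congr
     · with_reducible repeat' first
        | exact .zero | exact .e2 | exact .e3 | exact .e4 | exact .e5 | exact .e6
        | apply Represents.smul | apply Represents.add
     · grind)

theorem HasModel.isomorphic_B14 (h : HasModel A l r) (hdim : Module.finrank ℂ A = 6) (c : ℂ)
    (hlr : l * r = l ^ 3) (hr : r ^ 2 = algebraMap ℂ Q c * l ^ 3) (hl : l ^ 4 = 0) :
    Isomorphic A (TableAlgebra (B14 c)) := by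
  apply h.isomorphic_of_represents hdim (B14 c) l r (l ^ 2) (l ^ 3) <;>
    simp only [B14] <;>
    (apply Represents.congr
     · with_reducible repeat' first
        | exact .zero | exact .e2 | exact .e3 | exact .e4 | exact .e5 | exact .e6
        | apply Represents.smul
     · grind)

theorem HasModel.isomorphic_B15 (h : HasModel A l r) (hdim : Module.finrank ℂ A = 6) (c : ℂ)
    (hlr : l * r = l ^ 2 + l ^ 3) (hr : r ^ 2 = l * r + algebraMap ℂ Q c * l ^ 3)
    (hl : l ^ 4 = 0) :
    Isomorphic A (TableAlgebra (B15 c)) := by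
  apply h.isomorphic_of_represents hdim (B15 c) l (r - l) (l ^ 2) (l ^ 3) <;>
    simp only [B15] <;>
    (apply Represents.congr
     · with_reducible repeat' first
        | exact .zero | exact .e2 | exact .e3 | exact .e4 | exact .e5 | exact .e6
        | apply Represents.smul | apply Represents.add
     · grind)

theorem HasModel.isomorphic_B19 (h : HasModel A l r) (hdim : Module.finrank ℂ A = 6)
    (hl : l = r ^ 2) (hr : r ^ 5 = 0) :
    Isomorphic A (TableAlgebra B19) := by
  apply h.isomorphic_of_represents hdim B19 r (r ^ 2) (r ^ 3) (r ^ 4) <;>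
    simp only [B19] <;>
    (apply Represents.congr
     · with_reducible repeat' first
        | exact .zero | exact .e2 | exact .e3 | exact .e4 | exact .e5 | exact .e6
     · grind)

theorem HasModel.isomorphic_B20 (h : HasModel A l r) (hdim : Module.finrank ℂ A = 6)
    (hl : l = r ^ 3) (hr : r ^ 5 = 0) :
    Isomorphic A (TableAlgebra B20) := by
  apply h.isomorphic_of_represents hdim B20 r (r ^ 2) (r ^ 3) (r ^ 4) <;>
    simp only [B20] <;>
    (apply Represents.congr
     · with_reducible repeat' first
        | exact .zero | exact .e2 | exact .e3 | exact .e4 | exact .e5 | exact .e6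
     · grind)

theorem HasModel.isomorphic_B21 (h : HasModel A l r) (hdim : Module.finrank ℂ A = 6)
    (hl : l = r ^ 4) (hr : r ^ 5 = 0) :
    Isomorphic A (TableAlgebra B21) := by
  apply h.isomorphic_of_represents hdim B21 r (r ^ 2) (r ^ 3) (r ^ 4) <;>
    simp only [B21] <;>
    (apply Represents.congr
     · with_reducible repeat' first
        | exact .zero | exact .e2 | exact .e3 | exact .e4 | exact .e5 | exact .e6
     · grind)

theorem HasModel.isomorphic_B22 (h : HasModel A l r) (hdim : Module.finrank ℂ A = 6)
    (hl : l = 0) (hr : r ^ 5 = 0) :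
    Isomorphic A (TableAlgebra B22) := by
  apply h.isomorphic_of_represents hdim B22 r (r ^ 2) (r ^ 3) (r ^ 4) <;>
    simp only [B22] <;>
    (apply Represents.congr
     · with_reducible repeat' first
        | exact .zero | exact .e2 | exact .e3 | exact .e4 | exact .e5 | exact .e6
     · grind)

theorem HasModel.isomorphic_B23 (h : HasModel A l r) (hdim : Module.finrank ℂ A = 6)
    (hr : r = l ^ 2) (hl : l ^ 5 = 0) :
    Isomorphic A (TableAlgebra B23) := by
  apply h.isomorphic_of_represents hdim B23 l (l ^ 2) (l ^ 3) (l ^ 4) <;>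
    simp only [B23] <;>
    (apply Represents.congr
     · with_reducible repeat' first
        | exact .zero | exact .e2 | exact .e3 | exact .e4 | exact .e5 | exact .e6
     · grind)

theorem HasModel.isomorphic_B24 (h : HasModel A l r) (hdim : Module.finrank ℂ A = 6)
    (hr : r = l + l ^ 2) (hl : l ^ 5 = 0) :
    Isomorphic A (TableAlgebra B24) := by
  subst hr
  apply h.isomorphic_of_represents hdim B24 l (l ^ 2) (l ^ 3) (l ^ 4) <;>
    simp only [B24] <;>
    (apply Represents.congr
     · with_reducible repeat' first
        | exact .zero | exact .e2 | exact .e3 | exact .e4 | exact .e5 | exact .e6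
        | apply Represents.add
     · grind)

theorem HasModel.isomorphic_B25 (h : HasModel A l r) (hdim : Module.finrank ℂ A = 6) (c : ℂ)
    (hr : r = algebraMap ℂ Q c * l) (hl : l ^ 5 = 0) :
    Isomorphic A (TableAlgebra (B25 c)) := by
  apply h.isomorphic_of_represents hdim (B25 c) l (l ^ 2) (l ^ 3) (l ^ 4) <;>
    simp only [B25] <;>
    (apply Represents.congr
     · with_reducible repeat' first
        | exact .zero | exact .e2 | exact .e3 | exact .e4 | exact .e5 | exact .e6
        | apply Represents.smul
     · grind)

theorem HasModel.isomorphic_B26 (h : HasModel A l r) (hdim : Module.finrank ℂ A = 6)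
    (hr : r = l ^ 4) (hl : l ^ 5 = 0) :
    Isomorphic A (TableAlgebra B26) := by
  apply h.isomorphic_of_represents hdim B26 l (l ^ 2) (l ^ 3) (l ^ 4) <;>
    simp only [B26] <;>
    (apply Represents.congr
     · with_reducible repeat' first
        | exact .zero | exact .e2 | exact .e3 | exact .e4 | exact .e5 | exact .e6
     · grind)

theorem HasModel.isomorphic_B27 (h : HasModel A l r) (hdim : Module.finrank ℂ A = 6)
    (hr : r = l + l ^ 4) (hl : l ^ 5 = 0) :
    Isomorphic A (TableAlgebra B27) := by
  subst hr
  apply h.isomorphic_of_represents hdim B27 l (l ^ 2) (l ^ 3) (l ^ 4) <;>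
    simp only [B27] <;>
    (apply Represents.congr
     · with_reducible repeat' first
        | exact .zero | exact .e2 | exact .e3 | exact .e4 | exact .e5 | exact .e6
        | apply Represents.add
     · grind)

theorem HasModel.isomorphic_B28 (h : HasModel A l r) (hdim : Module.finrank ℂ A = 6)
    (hr : r = l ^ 3) (hl : l ^ 5 = 0) :
    Isomorphic A (TableAlgebra B28) := by
  apply h.isomorphic_of_represents hdim B28 l (l ^ 2) (l ^ 3) (l ^ 4) <;>
    simp only [B28] <;>
    (apply Represents.congr
     · with_reducible repeat' first
        | exact .zero | exact .e2 | exact .e3 | exact .e4 | exact .e5 | exact .e6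
     · grind)

theorem HasModel.isomorphic_B29 (h : HasModel A l r) (hdim : Module.finrank ℂ A = 6)
    (hr : r = l + l ^ 3) (hl : l ^ 5 = 0) :
    Isomorphic A (TableAlgebra B29) := by
  subst hr
  apply h.isomorphic_of_represents hdim B29 l (l ^ 2) (l ^ 3) (l ^ 4) <;>
    simp only [B29] <;>
    (apply Represents.congr
     · with_reducible repeat' first
        | exact .zero | exact .e2 | exact .e3 | exact .e4 | exact .e5 | exact .e6
        | apply Represents.add
     · grind)

end Presentations

variable (A : Type*) [NonUnitalNonAssocRing A] [Module ℂ A] in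
/-- `A` is isomorphic to an algebra of the list. -/
def IsClassified : Prop := ∃ T : Table, IsListed T ∧ Isomorphic A (TableAlgebra T)

/-! ### Normalising truncated power series by a change of generator. -/

section NormalForms

variable {Q : Type*} [CommRing Q] [Algebra ℂ Q]

/-- A change of generator that brings a power series of order at least two into the form of a
monomial. -/
theorem exists_change_eq_pow {x y : Q} {a b c : ℂ}
    (hx : x = algebraMap ℂ Q a * y ^ 2 + algebraMap ℂ Q b * y ^ 3 + algebraMap ℂ Q c * y ^ 4)
    (hy : y ^ 5 = 0) :
    ∃ (s : ℂ) (p x' y' : Q), s ≠ 0 ∧ x' = x * (algebraMap ℂ Q s + y * p) ∧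
      y' = y * (algebraMap ℂ Q s + x * p) ∧ y' ^ 5 = 0 ∧
      (x' = y' ^ 2 ∨ x' = y' ^ 3 ∨ x' = y' ^ 4 ∨ x' = 0) := by
  suffices h : ∃ (s : ℂ) (p : Q), s ≠ 0 ∧
      (x * (algebraMap ℂ Q s + y * p) = (y * (algebraMap ℂ Q s + x * p)) ^ 2 ∨
       x * (algebraMap ℂ Q s + y * p) = (y * (algebraMap ℂ Q s + x * p)) ^ 3 ∨
       x * (algebraMap ℂ Q s + y * p) = (y * (algebraMap ℂ Q s + x * p)) ^ 4 ∨
       x * (algebraMap ℂ Q s + y * p) = 0) by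
    obtain ⟨s, p, hs, h⟩ := h
    exact ⟨s, p, _, _, hs, rfl, rfl, by rw [mul_pow, hy, zero_mul], h⟩
  by_cases ha : a = 0
  · by_cases hb : b = 0
    · by_cases hc : c = 0
      · exact ⟨1, 0, one_ne_zero, .inr (.inr (.inr (by simp [hx, ha, hb, hc])))⟩
      · obtain ⟨s, hs⟩ := IsAlgClosed.exists_pow_nat_eq c (n := 3) (by norm_num)
        refine ⟨s, 0, fun h => hc (by rw [← hs, h]; norm_num), .inr (.inr (.inl ?_))⟩
        rw [hx, ha, hb, ← hs]
        simp only [map_zero, map_pow]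
        ring
    · obtain ⟨s, hs⟩ := IsAlgClosed.exists_pow_nat_eq b (n := 2) (by norm_num)
      have hs0 : s ≠ 0 := fun h => hb (by rw [← hs, h]; norm_num)
      -- The right side is `s ^ 3 y ^ 3` up to order six. Its `y ^ 3` coefficient forces `s ^ 2 =
      -- b`, and the absence of `y ^ 4` forces `c s + b p = 0`.
      refine ⟨s, algebraMap ℂ Q (-c / s), hs0, .inr (.inl ?_)⟩
      have h1 : algebraMap ℂ Q s ^ 2 = algebraMap ℂ Q b := by rw [← map_pow, hs]
      have h2 : algebraMap ℂ Q s * algebraMap ℂ Q (-c / s) = -algebraMap ℂ Q c := by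
        rw [← map_mul, mul_div_cancel₀ _ hs0, map_neg]
      rw [ha] at hx
      generalize algebraMap ℂ Q s = S at *
      generalize algebraMap ℂ Q b = B at *
      generalize algebraMap ℂ Q c = C at *
      generalize algebraMap ℂ Q (-c / s) = P at *
      rw [map_zero, zero_mul, zero_add] at hx
      subst hx
      grind
  · obtain ⟨t, ht⟩ : ∃ t : ℂ, a * t = b ^ 2 - 2 * a ^ 2 * b - c * a :=
      ⟨_, mul_div_cancel₀ _ ha⟩
    -- Comparing coefficients of `y ^ 2`, `y ^ 3` and `y ^ 4` gives in turn `s = a`, the constant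
    -- term `-b` of `p`, and its linear term `t`.
    refine ⟨a, -algebraMap ℂ Q b + algebraMap ℂ Q t * y, ha, .inl ?_⟩
    have h1 := congrArg (algebraMap ℂ Q) ht
    simp only [map_mul, map_sub, map_pow, map_ofNat] at h1
    generalize algebraMap ℂ Q a = S at *
    generalize algebraMap ℂ Q b = B at *
    generalize algebraMap ℂ Q c = C at *
    generalize algebraMap ℂ Q t = P at *
    subst hx
    grind

/-- A change of generator that brings `r`, given as a multiple of `l` that is neither nilpotent of
higher order nor tangent to `l`, into the form of a scalar multiple. -/
theorem exists_change_eq_smul {l r : Q} {m a b c : ℂ} (hm : m ≠ 0) (hm1 : m ≠ 1)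
    (hr : r = algebraMap ℂ Q m * l + algebraMap ℂ Q a * l ^ 2 + algebraMap ℂ Q b * l ^ 3 +
      algebraMap ℂ Q c * l ^ 4) (hl : l ^ 5 = 0) :
    ∃ p : Q, r * (algebraMap ℂ Q 1 + l * p) =
      algebraMap ℂ Q m * (l * (algebraMap ℂ Q 1 + r * p)) := by
  have hln : IsNilpotent l := ⟨5, hl⟩
  obtain ⟨k, hk⟩ := (isUnit_algebraMap_add hm ((Commute.all l (algebraMap ℂ Q a +
    algebraMap ℂ Q b * l + algebraMap ℂ Q c * l ^ 2)).isNilpotent_mul_right hln)).exists_right_inv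
  have hm' : algebraMap ℂ Q (m - 1)⁻¹ * (algebraMap ℂ Q m - 1) = 1 := by
    rw [← map_one (algebraMap ℂ Q), ← map_sub, ← map_mul, inv_mul_cancel₀ (sub_ne_zero.mpr hm1)]
  -- With `r = l (m + l U)`, the claim reads `l ^ 2 U = (m - 1) l ^ 2 (m + l U) p`, which is solved
  -- by `p = U / ((m - 1) (m + l U))`.
  refine ⟨algebraMap ℂ Q (m - 1)⁻¹ * k *
    (algebraMap ℂ Q a + algebraMap ℂ Q b * l + algebraMap ℂ Q c * l ^ 2), ?_⟩
  rw [map_one]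
  generalize algebraMap ℂ Q (m - 1)⁻¹ = N at *
  generalize algebraMap ℂ Q m = M at *
  generalize algebraMap ℂ Q a = S at *
  generalize algebraMap ℂ Q b = B at *
  generalize algebraMap ℂ Q c = C at *
  have hr' : r = l * (M + l * (S + B * l + C * l ^ 2)) := by rw [hr]; ring
  generalize S + B * l + C * l ^ 2 = U at *
  rw [hr']
  linear_combination -l ^ 2 * U * N * (M - 1) * hk - l ^ 2 * U * hm'

/-- A change of generator that brings `r`, given as a power series tangent to `l`, into the form
`l + l ^ k`. -/
theorem exists_change_eq_add_pow {l r : Q} {a b c : ℂ}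
    (hr : r = l + algebraMap ℂ Q a * l ^ 2 + algebraMap ℂ Q b * l ^ 3 + algebraMap ℂ Q c * l ^ 4)
    (hl : l ^ 5 = 0) :
    ∃ (s : ℂ) (p l' r' : Q), s ≠ 0 ∧ l' = l * (algebraMap ℂ Q s + r * p) ∧
      r' = r * (algebraMap ℂ Q s + l * p) ∧ l' ^ 5 = 0 ∧
      (r' = l' + l' ^ 2 ∨ r' = l' + l' ^ 3 ∨ r' = l' + l' ^ 4 ∨ r' = l') := by
  -- The term `l r p` is common to the new `l` and the new `r`, so their difference is just `(r - l)
  -- s`. As `r` is a unit times `l`, one can write `r p = l X` with `X` arbitrary.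
  suffices h : ∃ (s : ℂ) (X : Q), s ≠ 0 ∧
      ((r - l) * algebraMap ℂ Q s = (l * (algebraMap ℂ Q s + l * X)) ^ 2 ∨
       (r - l) * algebraMap ℂ Q s = (l * (algebraMap ℂ Q s + l * X)) ^ 3 ∨
       (r - l) * algebraMap ℂ Q s = (l * (algebraMap ℂ Q s + l * X)) ^ 4 ∨
       (r - l) * algebraMap ℂ Q s = 0) by
    obtain ⟨s, X, hs, h⟩ := h
    have hln : IsNilpotent l := ⟨5, hl⟩
    obtain ⟨k, hk⟩ := (isUnit_algebraMap_add one_ne_zero ((Commute.all l (algebraMap ℂ Q a +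
      algebraMap ℂ Q b * l + algebraMap ℂ Q c * l ^ 2)).isNilpotent_mul_right
      hln)).exists_right_inv
    rw [map_one] at hk
    have hrp : r * (X * k) = l * X := by
      rw [hr]
      linear_combination l * X * hk
    refine ⟨s, X * k, _, _, hs, rfl, rfl, by rw [mul_pow, hl, zero_mul], ?_⟩
    have e1 : r * (algebraMap ℂ Q s + l * (X * k)) =
        l * (algebraMap ℂ Q s + r * (X * k)) + (r - l) * algebraMap ℂ Q s := by ring
    rw [e1, hrp]
    rcases h with h | h | h | h <;> simp [h]
  by_cases ha : a = 0
  · by_cases hb : b = 0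
    · by_cases hc : c = 0
      · exact ⟨1, 0, one_ne_zero, .inr (.inr (.inr (by simp [hr, ha, hb, hc])))⟩
      · obtain ⟨s, hs⟩ := IsAlgClosed.exists_pow_nat_eq c (n := 3) (by norm_num)
        refine ⟨s, 0, fun h => hc (by rw [← hs, h]; norm_num), .inr (.inr (.inl ?_))⟩
        rw [hr, ha, hb, ← hs]
        simp only [map_zero, map_pow]
        ring
    · obtain ⟨s, hs⟩ := IsAlgClosed.exists_pow_nat_eq b (n := 2) (by norm_num)
      have hs0 : s ≠ 0 := fun h => hb (by rw [← hs, h]; norm_num)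
      obtain ⟨t, ht⟩ : ∃ t : ℂ, s * c = 3 * s ^ 2 * t :=
        ⟨c / (3 * s), by field_simp⟩
      refine ⟨s, algebraMap ℂ Q t, hs0, .inr (.inl ?_)⟩
      have h1 : algebraMap ℂ Q s ^ 2 = algebraMap ℂ Q b := by rw [← map_pow, hs]
      have h2 := congrArg (algebraMap ℂ Q) ht
      simp only [map_mul, map_pow, map_ofNat] at h2
      rw [hr, ha, ← h1, map_zero]
      generalize algebraMap ℂ Q s = S at *
      generalize algebraMap ℂ Q t = X at *
      linear_combination l ^ 4 * h2 - (3 * S * X ^ 2 + l * X ^ 3) * hl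
  -- With `s = a` and `X = u + v l`, these are the conditions in degrees three and four, divided by
  -- `a` in degree three.
  · obtain ⟨u, hu⟩ : ∃ u : ℂ, b = 2 * u := ⟨b / 2, by ring⟩
    obtain ⟨v, hv⟩ : ∃ v : ℂ, a * c = 2 * a * v + u ^ 2 :=
      ⟨(a * c - u ^ 2) / (2 * a), by field_simp; ring⟩
    refine ⟨a, algebraMap ℂ Q u + algebraMap ℂ Q v * l, ha, .inl ?_⟩
    have h2 := congrArg (algebraMap ℂ Q) hv
    simp only [map_mul, map_pow, map_ofNat, map_add] at h2
    rw [hr, hu]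
    simp only [map_mul, map_ofNat]
    generalize algebraMap ℂ Q a = S at *
    generalize algebraMap ℂ Q u = U at *
    generalize algebraMap ℂ Q v = V at *
    linear_combination l ^ 4 * h2 - (2 * U * V + V ^ 2 * l) * hl

end NormalForms

/-! ### From the shape of the relations to an entry of the list. -/

section Families

variable {A : Type*} [NonUnitalNonAssocRing A] [Module ℂ A] [IsScalarTower ℂ A A]
  [SMulCommClass ℂ A A] {Q : Type*} [CommRing Q] [Algebra ℂ Q] {l r : Q}

theorem HasModel.scale (h : HasModel A l r) {c : ℂ} (hc : c ≠ 0) :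
    HasModel A (algebraMap ℂ Q c * l) (algebraMap ℂ Q c * r) := by
  simpa [mul_comm] using h.change hc 0

/-- The algebras for which `Q` is generated by `r`, with `l` of order at least two. -/
theorem HasModel.isClassified_of_left (h : HasModel A l r) (hdim : Module.finrank ℂ A = 6)
    {a b c : ℂ} (hl : l = algebraMap ℂ Q a * r ^ 2 + algebraMap ℂ Q b * r ^ 3 +
      algebraMap ℂ Q c * r ^ 4) (hr : r ^ 5 = 0) : IsClassified A := by
  obtain ⟨s, p, l', r', hs, hl', hr', h5, hc⟩ := exists_change_eq_pow hl hr
  have h' : HasModel A l' r' := by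
    rw [hl', hr']
    exact h.change hs p
  rcases hc with hc | hc | hc | hc
  · exact ⟨_, .b19, h'.isomorphic_B19 hdim hc h5⟩
  · exact ⟨_, .b20, h'.isomorphic_B20 hdim hc h5⟩
  · exact ⟨_, .b21, h'.isomorphic_B21 hdim hc h5⟩
  · exact ⟨_, .b22, h'.isomorphic_B22 hdim hc h5⟩

/-- The algebras for which `Q` is generated by `l`. -/
theorem HasModel.isClassified_of_right (h : HasModel A l r) (hdim : Module.finrank ℂ A = 6)
    {m a b c : ℂ} (hr : r = algebraMap ℂ Q m * l + algebraMap ℂ Q a * l ^ 2 +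
      algebraMap ℂ Q b * l ^ 3 + algebraMap ℂ Q c * l ^ 4) (hl : l ^ 5 = 0) :
    IsClassified A := by
  by_cases hm : m = 0
  · rw [hm, map_zero, zero_mul, zero_add] at hr
    obtain ⟨s, p, r', l', hs, hr', hl', h5, hc⟩ := exists_change_eq_pow hr hl
    have h' : HasModel A l' r' := by
      rw [hl', hr']
      exact h.change hs p
    rcases hc with hc | hc | hc | hc
    · exact ⟨_, .b23, h'.isomorphic_B23 hdim hc h5⟩
    · exact ⟨_, .b28, h'.isomorphic_B28 hdim hc h5⟩
    · exact ⟨_, .b26, h'.isomorphic_B26 hdim hc h5⟩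
    · exact ⟨_, .b25 0, h'.isomorphic_B25 hdim 0 (by simp [hc]) h5⟩
  by_cases hm1 : m = 1
  · rw [hm1, map_one, one_mul] at hr
    obtain ⟨s, p, l', r', hs, hl', hr', h5, hc⟩ := exists_change_eq_add_pow hr hl
    have h' : HasModel A l' r' := by
      rw [hl', hr']
      exact h.change hs p
    rcases hc with hc | hc | hc | hc
    · exact ⟨_, .b24, h'.isomorphic_B24 hdim hc h5⟩
    · exact ⟨_, .b29, h'.isomorphic_B29 hdim hc h5⟩
    · exact ⟨_, .b27, h'.isomorphic_B27 hdim hc h5⟩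
    · exact ⟨_, .b25 1, h'.isomorphic_B25 hdim 1 (by simp [hc]) h5⟩
  · obtain ⟨p, hp⟩ := exists_change_eq_smul hm hm1 hr hl
    exact ⟨_, .b25 m, (h.change one_ne_zero p).isomorphic_B25 hdim m hp
      (by rw [mul_pow, hl, zero_mul])⟩

/-- The algebras for which all cubic monomials vanish. -/
theorem HasModel.isClassified_of_quadric (h : HasModel A l r) (hdim : Module.finrank ℂ A = 6)
    {a b c : ℂ} (h0 : a ≠ 0 ∨ b ≠ 0 ∨ c ≠ 0)
    (hq : algebraMap ℂ Q a * l ^ 2 + algebraMap ℂ Q b * (l * r) + algebraMap ℂ Q c * r ^ 2 = 0)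
    (h1 : l ^ 3 = 0) (h2 : l ^ 2 * r = 0) (h3 : l * r ^ 2 = 0) (h4 : r ^ 3 = 0) :
    IsClassified A := by
  have hinv : ∀ {s : ℂ}, s ≠ 0 → algebraMap ℂ Q s⁻¹ * algebraMap ℂ Q s = 1 := fun hs => by
    rw [← map_mul, inv_mul_cancel₀ hs, map_one]
  by_cases ha : a = 0
  · by_cases hc : c = 0
    · have hb : b ≠ 0 := by simpa [ha, hc] using h0
      refine ⟨_, .b01, h.isomorphic_B01 hdim ?_ h1 h4⟩
      simp only [ha, hc, map_zero, zero_mul, zero_add, add_zero] at hq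
      linear_combination algebraMap ℂ Q b⁻¹ * hq - l * r * hinv hb
    · refine ⟨_, .b02 (-(c⁻¹ * b)), h.isomorphic_B02 hdim _ ?_ h1 h2 h3 h4⟩
      simp only [ha, map_zero, zero_mul, zero_add, map_neg, map_mul] at hq ⊢
      linear_combination algebraMap ℂ Q c⁻¹ * hq - r ^ 2 * hinv hc
  · refine ⟨_, .b03 (-(a⁻¹ * c)) (-(a⁻¹ * b)), h.isomorphic_B03 hdim _ _ ?_ h1 h2 h3 h4⟩
    simp only [map_neg, map_mul] at hq ⊢
    linear_combination algebraMap ℂ Q a⁻¹ * hq - l ^ 2 * hinv ha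

/-- The algebras for which the cubic part is spanned by `r ^ 3`, and `l ^ 2` and `l r` are
cubic. -/
theorem HasModel.isClassified_of_cubic_right (h : HasModel A l r)
    (hdim : Module.finrank ℂ A = 6) {a b : ℂ} (hl : l ^ 2 = algebraMap ℂ Q a * r ^ 3)
    (hlr : l * r = algebraMap ℂ Q b * r ^ 3) (hr : r ^ 4 = 0) : IsClassified A := by
  by_cases hb : b = 0
  · rw [hb, map_zero, zero_mul] at hlr
    by_cases ha : a = 0
    · rw [ha, map_zero, zero_mul] at hl
      exact ⟨_, .b11, h.isomorphic_B11 hdim hl hlr hr⟩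
    · exact ⟨_, .b10, (h.scale ha).isomorphic_B10 hdim
        (by linear_combination algebraMap ℂ Q a ^ 2 * hl)
        (by linear_combination algebraMap ℂ Q a ^ 2 * hlr)⟩
  · have hab : algebraMap ℂ Q (a / b) * algebraMap ℂ Q b = algebraMap ℂ Q a := by
      rw [← map_mul, div_mul_cancel₀ _ hb]
    -- Scaling by `s` divides the coefficient of a cubic term in a quadratic relation by `s`; `s =
    -- b` makes the second coefficient one.
    exact ⟨_, .b09 (a / b), (h.scale hb).isomorphic_B09 hdim _
      (by linear_combination algebraMap ℂ Q b ^ 2 * hl - algebraMap ℂ Q b ^ 2 * r ^ 3 * hab)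
      (by linear_combination algebraMap ℂ Q b ^ 2 * hlr)
      (by rw [mul_pow, hr, mul_zero])⟩

/-- The algebras for which the cubic part is spanned by `l ^ 3`, and `l (r - m l)` is zero and
`r (r - m l)` is cubic. -/
theorem HasModel.isClassified_of_cubic_left_zero (h : HasModel A l r)
    (hdim : Module.finrank ℂ A = 6) {m b : ℂ} (hlr : l * r = algebraMap ℂ Q m * l ^ 2)
    (hr : r ^ 2 = algebraMap ℂ Q m * (l * r) + algebraMap ℂ Q b * l ^ 3) (hl : l ^ 4 = 0) :
    IsClassified A := by
  by_cases hb : b = 0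
  · rw [hb, map_zero, zero_mul, add_zero] at hr
    exact ⟨_, .b12 m, h.isomorphic_B12 hdim m hlr hr hl⟩
  · exact ⟨_, .b13 m, (h.scale hb).isomorphic_B13 hdim m
      (by linear_combination algebraMap ℂ Q b ^ 2 * hlr)
      (by linear_combination algebraMap ℂ Q b ^ 2 * hr)⟩

/-- The algebras for which the cubic part is spanned by `l ^ 3`, and `l (r - m l)` and
`r (r - m l)` are cubic. -/
theorem HasModel.isClassified_of_cubic_left (h : HasModel A l r)
    (hdim : Module.finrank ℂ A = 6) {m a b : ℂ}
    (hlr : l * r = algebraMap ℂ Q m * l ^ 2 + algebraMap ℂ Q a * l ^ 3)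
    (hr : r ^ 2 = algebraMap ℂ Q m * (l * r) + algebraMap ℂ Q b * l ^ 3) (hl : l ^ 4 = 0) :
    IsClassified A := by
  by_cases ha : a = 0
  · rw [ha, map_zero, zero_mul, add_zero] at hlr
    exact h.isClassified_of_cubic_left_zero hdim hlr hr hl
  have hab : algebraMap ℂ Q (b / a) * algebraMap ℂ Q a = algebraMap ℂ Q b := by
    rw [← map_mul, div_mul_cancel₀ _ ha]
  by_cases hm : m = 0
  · simp only [hm, map_zero, zero_mul, zero_add] at hlr hr
    exact ⟨_, .b14 (b / a), (h.scale ha).isomorphic_B14 hdim _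
      (by linear_combination algebraMap ℂ Q a ^ 2 * hlr)
      (by linear_combination algebraMap ℂ Q a ^ 2 * hr - algebraMap ℂ Q a ^ 2 * l ^ 3 * hab)
      (by rw [mul_pow, hl, mul_zero])⟩
  by_cases hm1 : m = 1
  · simp only [hm1, map_one, one_mul] at hlr hr
    exact ⟨_, .b15 (b / a), (h.scale ha).isomorphic_B15 hdim _
      (by linear_combination algebraMap ℂ Q a ^ 2 * hlr)
      (by linear_combination algebraMap ℂ Q a ^ 2 * hr - algebraMap ℂ Q a ^ 2 * l ^ 3 * hab)
      (by rw [mul_pow, hl, mul_zero])⟩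
  -- Replacing the generator by `a + ι t`, where here `a` denotes the generator, changes the cubic
  -- coefficient of `l r - m l ^ 2` by `t m (1 - m)`. This removes it exactly because `m` is neither
  -- `0` nor `1`. The other coefficient `b` changes by `t m ^ 2 (1 - m)`, that is, by minus `m`
  -- times the removed coefficient.
  obtain ⟨t, ht⟩ : ∃ t : ℂ, a + t * m * (1 - m) = 0 :=
    ⟨-a / (m * (1 - m)), by
      have : 1 - m ≠ 0 := sub_ne_zero.mpr (Ne.symm hm1)
      field_simp
      ring⟩
  have ht' := congrArg (algebraMap ℂ Q) ht
  simp only [map_add, map_mul, map_sub, map_one, map_zero] at ht'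
  refine (h.change one_ne_zero (algebraMap ℂ Q t)).isClassified_of_cubic_left_zero hdim
    (m := m) (b := b - a * m) ?_ ?_ (by rw [mul_pow, hl, zero_mul])
  · simp only [map_one]
    generalize algebraMap ℂ Q t = T at *
    generalize algebraMap ℂ Q m = M at *
    generalize algebraMap ℂ Q a = S at *
    generalize algebraMap ℂ Q b = B at *
    have e1 : l ^ 2 * r = M * l ^ 3 := by linear_combination l * hlr + S * hl
    have e2 : l * r ^ 2 = M ^ 2 * l ^ 3 := by linear_combination l * hr + M * e1 + B * hl
    have e3 : l ^ 2 * r ^ 2 = 0 := by linear_combination l * e2 + M ^ 2 * hl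
    linear_combination hlr + T * e1 + T * e2 + T ^ 2 * e3 - 2 * M * T * e1 - M * T ^ 2 * e3 +
      l ^ 3 * ht'
  · simp only [map_one, map_sub, map_mul]
    generalize algebraMap ℂ Q t = T at *
    generalize algebraMap ℂ Q m = M at *
    generalize algebraMap ℂ Q a = S at *
    generalize algebraMap ℂ Q b = B at *
    have e1 : l ^ 2 * r = M * l ^ 3 := by linear_combination l * hlr + S * hl
    have e2 : l * r ^ 2 = M ^ 2 * l ^ 3 := by linear_combination l * hr + M * e1 + B * hl
    have e3 : l ^ 2 * r ^ 2 = 0 := by linear_combination l * e2 + M ^ 2 * hl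
    have e4 : l ^ 3 * (1 + r * T) ^ 3 = l ^ 3 := by
      linear_combination (3 * T * l + 3 * T ^ 2 * l * r + T ^ 3 * l * r ^ 2) * e1 +
        M * (3 * T + 3 * T ^ 2 * r + T ^ 3 * r ^ 2) * hl
    rw [mul_pow l, e4]
    linear_combination hr + 2 * T * e2 + T ^ 2 * e3 - M * T * e1 - M * T * e2 - M * T ^ 2 * e3 +
      M * l ^ 3 * ht'

end Families

/-! ### The filtration of `Q` by powers of its maximal ideal. -/

section LocalAlgebra

variable {Q : Type*} [CommRing Q] [Algebra ℂ Q] {l r : Q}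

/-- The kernels of the powers of multiplication by `x` are stationary from the dimension of `Q` on.
-/
theorem pow_five_eq_zero [FiniteDimensional ℂ Q] (hQ : Module.finrank ℂ Q ≤ 5) {x : Q}
    (hx : IsNilpotent x) : x ^ 5 = 0 := by
  obtain ⟨n, hn⟩ := hx
  have h := Module.End.ker_pow_le_ker_pow_finrank (LinearMap.mulLeft ℂ x) n
  have h1 : (1 : Q) ∈ LinearMap.ker (LinearMap.mulLeft ℂ x ^ n) := by
    simp [LinearMap.pow_mulLeft, hn]
  have h2 : x ^ Module.finrank ℂ Q = 0 := by simpa [LinearMap.pow_mulLeft] using h h1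
  exact pow_eq_zero_of_le hQ h2

/-- If every element is a scalar modulo `x`, then it is a polynomial in `x` modulo `x ^ 3`. -/
theorem exists_expansion {x : Q} (h : ∀ q : Q, ∃ (s : ℂ) (y : Q), q = algebraMap ℂ Q s + x * y)
    (q : Q) : ∃ (a b c : ℂ) (y : Q), q = algebraMap ℂ Q a + algebraMap ℂ Q b * x +
      algebraMap ℂ Q c * x ^ 2 + x ^ 3 * y := by
  obtain ⟨a, y, rfl⟩ := h q
  obtain ⟨b, z, rfl⟩ := h y
  obtain ⟨c, w, rfl⟩ := h z
  exact ⟨a, b, c, w, by ring⟩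

omit [Algebra ℂ Q] in
theorem exists_of_mem_span_pair_pow_succ {k : ℕ} {z : Q}
    (hz : z ∈ Ideal.span {l, r} ^ (k + 1)) :
    ∃ s ∈ Ideal.span {l, r} ^ k, ∃ t ∈ Ideal.span {l, r} ^ k, z = l * s + r * t := by
  rw [pow_succ', Ideal.span_insert, Ideal.sup_mul, Submodule.mem_sup] at hz
  obtain ⟨x, hx, y, hy, rfl⟩ := hz
  obtain ⟨s, hs, rfl⟩ := Ideal.mem_span_singleton_mul.mp hx
  obtain ⟨t, ht, rfl⟩ := Ideal.mem_span_singleton_mul.mp hy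
  rw [← Ideal.span_insert] at hs ht
  exact ⟨s, hs, t, ht, rfl⟩

omit [Algebra ℂ Q] in
theorem exists_of_mem_span_pair_sq {z : Q} (hz : z ∈ Ideal.span {l, r} ^ 2) :
    ∃ x y w : Q, z = l ^ 2 * x + l * r * y + r ^ 2 * w := by
  obtain ⟨s, hs, t, ht, rfl⟩ := exists_of_mem_span_pair_pow_succ hz
  rw [pow_one, Ideal.mem_span_pair] at hs ht
  obtain ⟨a, b, rfl⟩ := hs
  obtain ⟨c, d, rfl⟩ := ht
  exact ⟨a, b + c, d, by ring⟩

omit [Algebra ℂ Q] in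
theorem left_mul_mem_pow {k : ℕ} {z : Q} (hz : z ∈ Ideal.span {l, r} ^ k) :
    l * z ∈ Ideal.span {l, r} ^ (k + 1) := by
  rw [pow_succ']
  exact Ideal.mul_mem_mul (Ideal.subset_span (by simp)) hz

omit [Algebra ℂ Q] in
theorem right_mul_mem_pow {k : ℕ} {z : Q} (hz : z ∈ Ideal.span {l, r} ^ k) :
    r * z ∈ Ideal.span {l, r} ^ (k + 1) := by
  rw [pow_succ']
  exact Ideal.mul_mem_mul (Ideal.subset_span (by simp)) hz

/-- The powers of a nilpotent ideal decrease strictly until they vanish. -/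
theorem finrank_pow_succ_lt [FiniteDimensional ℂ Q] {I : Ideal Q} (hI : IsNilpotent I) {k : ℕ}
    (hk : I ^ k ≠ ⊥) :
    Module.finrank ℂ ((I ^ (k + 1)).restrictScalars ℂ) <
      Module.finrank ℂ ((I ^ k).restrictScalars ℂ) := by
  refine Submodule.finrank_lt_finrank_of_lt (lt_of_le_of_ne
    (fun _ hx => Ideal.pow_le_pow_right k.le_succ hx) fun h => hk ?_)
  have h : I ^ (k + 1) = I ^ k := Submodule.restrictScalars_injective ℂ _ _ h
  obtain ⟨n, hn⟩ := hI
  have key : ∀ j, I ^ (k + j) = I ^ k := by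
    intro j
    induction j with
    | zero => rfl
    | succ j ih => rw [← add_assoc, pow_succ, ih, ← pow_succ, h]
  rw [← key n, pow_add, hn]
  simp

end LocalAlgebra

/-! ### Case distinction on the position of `l` and `r` in the filtration. -/

section Classification

variable {A : Type*} [NonUnitalNonAssocRing A] [Module ℂ A] [IsScalarTower ℂ A A]
  [SMulCommClass ℂ A A] {Q : Type*} [CommRing Q] [Algebra ℂ Q] {l r : Q}

/-- A relation `l = x l ^ 2 + y l r + z r ^ 2` can be solved for `l`, because `1 - x l - y r` is a
unit. Hence `l` is a multiple of `r ^ 2` and `Q` consists of polynomials in `r`. -/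
theorem HasModel.isClassified_of_left_mem [FiniteDimensional ℂ Q] (h : HasModel A l r)
    (hdim : Module.finrank ℂ A = 6) (hQ : Module.finrank ℂ Q ≤ 5)
    (hlm : l ∈ Ideal.span {l, r} ^ 2) : IsClassified A := by
  obtain ⟨a, ι, hp⟩ := h
  have hl := hp.nilpotent_left
  have hr := hp.nilpotent_right
  obtain ⟨x, y, z, hxyz⟩ := exists_of_mem_span_pair_sq hlm
  have hu : IsNilpotent (l * x + r * y) := (Commute.all _ _).isNilpotent_add
    ((Commute.all _ _).isNilpotent_mul_right hl) ((Commute.all _ _).isNilpotent_mul_right hr)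
  obtain ⟨u, hu⟩ := hu.isUnit_one_sub.exists_right_inv
  have hlz : l = r ^ 2 * (z * u) := by linear_combination u * hxyz - l * hu
  have hres : ∀ q : Q, ∃ (s : ℂ) (y : Q), q = algebraMap ℂ Q s + r * y := fun q => by
    obtain ⟨s, x', y', hq⟩ := hp.residue q
    exact ⟨s, r * (z * u) * x' + y', by linear_combination hq + x' * hlz⟩
  obtain ⟨b, c, d, w, hw⟩ := exists_expansion hres (z * u)
  have h5 := pow_five_eq_zero hQ hr
  refine HasModel.isClassified_of_left ⟨a, ι, hp⟩ hdim (a := b) (b := c) (c := d) ?_ h5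
  linear_combination hlz + r ^ 2 * hw + w * h5

/-- As before, the relation can be solved for `r`, now as a multiple of `l`, and `Q` consists of
polynomials in `l`. -/
theorem HasModel.isClassified_of_right_mem [FiniteDimensional ℂ Q] (h : HasModel A l r)
    (hdim : Module.finrank ℂ A = 6) (hQ : Module.finrank ℂ Q ≤ 5) {m : ℂ}
    (hrm : r - algebraMap ℂ Q m * l ∈ Ideal.span {l, r} ^ 2) : IsClassified A := by
  obtain ⟨a, ι, hp⟩ := h
  have hl := hp.nilpotent_left
  have hr := hp.nilpotent_right
  obtain ⟨x, y, z, hxyz⟩ := exists_of_mem_span_pair_sq hrm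
  have hu : IsNilpotent (l * y + r * z) := (Commute.all _ _).isNilpotent_add
    ((Commute.all _ _).isNilpotent_mul_right hl) ((Commute.all _ _).isNilpotent_mul_right hr)
  obtain ⟨u, hu⟩ := hu.isUnit_one_sub.exists_right_inv
  have hrz : r = l * ((algebraMap ℂ Q m + l * x) * u) := by
    linear_combination u * hxyz - r * hu
  generalize (algebraMap ℂ Q m + l * x) * u = v at hrz
  have hres : ∀ q : Q, ∃ (s : ℂ) (y : Q), q = algebraMap ℂ Q s + l * y := fun q => by
    obtain ⟨s, x', y', hq⟩ := hp.residue q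
    exact ⟨s, x' + v * y', by linear_combination hq + y' * hrz⟩
  obtain ⟨s, v', hv'⟩ := hres v
  obtain ⟨b, c, d, w, hw⟩ := exists_expansion hres v'
  have h5 := pow_five_eq_zero hQ hl
  refine HasModel.isClassified_of_right ⟨a, ι, hp⟩ hdim (m := s) (a := b) (b := c) (c := d) ?_ h5
  linear_combination hrz + l * hv' + l ^ 2 * hw + w * h5

/-- The case in which the cube of the maximal ideal vanishes. -/
theorem HasModel.isClassified_of_cube_eq_bot [FiniteDimensional ℂ Q] (h : HasModel A l r)
    (hdim : Module.finrank ℂ A = 6)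
    (h2 : Module.finrank ℂ ((Ideal.span {l, r} ^ 2).restrictScalars ℂ) ≤ 2)
    (h3 : Ideal.span {l, r} ^ 3 = ⊥) : IsClassified A := by
  have hl1 : l ∈ Ideal.span {l, r} ^ 1 := by simpa using Ideal.subset_span (by simp)
  have hr1 : r ∈ Ideal.span {l, r} ^ 1 := by simpa using Ideal.subset_span (by simp)
  have hll := left_mul_mem_pow hl1
  have hlr := left_mul_mem_pow hr1
  have hrr := right_mul_mem_pow hr1
  have hzero : ∀ {z}, z ∈ Ideal.span {l, r} ^ 3 → z = 0 := fun hz => by simpa [h3] using hz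
  let v : Fin 3 → (Ideal.span {l, r} ^ 2).restrictScalars ℂ :=
    ![⟨l * l, hll⟩, ⟨l * r, hlr⟩, ⟨r * r, hrr⟩]
  -- Three quadratic monomials in a space of dimension at most two satisfy a linear relation.
  have hv : ¬ LinearIndependent ℂ v := fun hv => by
    have := hv.fintype_card_le_finrank
    simp only [Fintype.card_fin] at this
    omega
  obtain ⟨g, hg, i, hi⟩ := Fintype.not_linearIndependent_iff.mp hv
  have hg' := congrArg Subtype.val hg
  simp only [Fin.sum_univ_three, v, Algebra.smul_def, Submodule.coe_add, Submodule.coe_smul,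
    Matrix.cons_val_zero, Matrix.cons_val_one, Matrix.cons_val, ZeroMemClass.coe_zero] at hg'
  refine h.isClassified_of_quadric hdim (a := g 0) (b := g 1) (c := g 2) ?_
    (by linear_combination hg') ?_ ?_ ?_ ?_
  · by_contra! hcon
    obtain ⟨h0, h1, h2⟩ := hcon
    fin_cases i
    · exact hi h0
    · exact hi h1
    · exact hi h2
  · linear_combination hzero (left_mul_mem_pow hll)
  · linear_combination hzero (left_mul_mem_pow hlr)
  · linear_combination hzero (left_mul_mem_pow hrr)
  · linear_combination hzero (right_mul_mem_pow hrr)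

/-- The case in which the cube of the maximal ideal does not vanish, but its fourth power does. -/
theorem HasModel.isClassified_of_cube_ne_bot [FiniteDimensional ℂ Q] (h : HasModel A l r)
    (hdim : Module.finrank ℂ A = 6)
    (h2 : Module.finrank ℂ ((Ideal.span {l, r} ^ 2).restrictScalars ℂ) ≤ 2)
    (h3 : Ideal.span {l, r} ^ 3 ≠ ⊥)
    (h3' : Module.finrank ℂ ((Ideal.span {l, r} ^ 3).restrictScalars ℂ) ≤ 1)
    (h23 : Module.finrank ℂ ((Ideal.span {l, r} ^ 3).restrictScalars ℂ) <
      Module.finrank ℂ ((Ideal.span {l, r} ^ 2).restrictScalars ℂ))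
    (h4 : Ideal.span {l, r} ^ 4 = ⊥) : IsClassified A := by
  have hl1 : l ∈ Ideal.span {l, r} ^ 1 := by simpa using Ideal.subset_span (by simp)
  have hr1 : r ∈ Ideal.span {l, r} ^ 1 := by simpa using Ideal.subset_span (by simp)
  have hll := left_mul_mem_pow hl1
  have hlr := left_mul_mem_pow hr1
  have hrr := right_mul_mem_pow hr1
  have hzero : ∀ {z}, z ∈ Ideal.span {l, r} ^ 4 → z = 0 := fun hz => by simpa [h4] using hz
  set M2 := (Ideal.span {l, r} ^ 2).restrictScalars ℂ
  set M3 := (Ideal.span {l, r} ^ 3).restrictScalars ℂ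
  have h32 : M3 ≤ M2 := fun _ hx => Ideal.pow_le_pow_right (by norm_num) hx
  -- `I ^ 2` has basis `t, w` with `w` spanning `I ^ 3`. Below, `X, Y, Z` are the `t`-coordinates of
  -- `l ^ 2, l r, r ^ 2`, and `l t = ξ w`, `r t = η w`.
  obtain ⟨t, ht2, ht3⟩ : ∃ t ∈ M2, t ∉ M3 := by
    by_contra! hcon
    have := Submodule.finrank_mono (R := ℂ) (show M2 ≤ M3 from hcon)
    omega
  obtain ⟨w, hw3, hw0, hw⟩ : ∃ w ∈ M3, w ≠ 0 ∧ ∀ z ∈ M3, ∃ c : ℂ, z = algebraMap ℂ Q c * w := by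
    obtain ⟨w, hw⟩ := finrank_le_one_iff.mp h3'
    refine ⟨w, w.2, fun hw0 => h3 ?_, fun z hz => ?_⟩
    · rw [eq_bot_iff]
      intro z hz
      obtain ⟨c, hc⟩ := hw ⟨z, hz⟩
      have := congrArg Subtype.val hc
      simpa [hw0] using this.symm
    · obtain ⟨c, hc⟩ := hw ⟨z, hz⟩
      exact ⟨c, by simpa [Algebra.smul_def] using (congrArg Subtype.val hc).symm⟩
  have h3pos : 0 < Module.finrank ℂ M3 := by
    rw [Nat.pos_iff_ne_zero]
    intro h0
    rw [Submodule.finrank_eq_zero] at h0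
    exact h3 ((Submodule.restrictScalars_eq_bot_iff _ _ _).mp h0)
  have hsum : M3 ⊔ Submodule.span ℂ {t} = M2 := by
    refine Submodule.eq_of_le_of_finrank_le (sup_le h32 (by simpa using ht2)) ?_
    have : Module.finrank ℂ M3 < Module.finrank ℂ (M3 ⊔ Submodule.span ℂ {t} : Submodule ℂ Q) :=
      Submodule.finrank_lt_finrank_of_lt (lt_of_le_of_ne le_sup_left fun heq =>
        ht3 (heq ▸ Submodule.mem_sup_right (Submodule.mem_span_singleton_self t)))
    omega
  have hdec : ∀ z ∈ M2, ∃ (x c : ℂ), z = algebraMap ℂ Q x * t + algebraMap ℂ Q c * w := by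
    intro z hz
    rw [← hsum, Submodule.mem_sup] at hz
    obtain ⟨y, hy, y', hy', rfl⟩ := hz
    obtain ⟨x, rfl⟩ := Submodule.mem_span_singleton.mp hy'
    obtain ⟨c, rfl⟩ := hw y hy
    exact ⟨x, c, by rw [Algebra.smul_def]; ring⟩
  have hinj : ∀ {c d : ℂ}, algebraMap ℂ Q c * w = algebraMap ℂ Q d * w → c = d := by
    intro c d hcd
    rw [← Algebra.smul_def, ← Algebra.smul_def] at hcd
    exact smul_left_injective ℂ hw0 hcd
  have hlw : l * w = 0 := hzero (left_mul_mem_pow hw3)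
  have hrw : r * w = 0 := hzero (right_mul_mem_pow hw3)
  obtain ⟨X, u, hX⟩ := hdec _ hll
  obtain ⟨Y, v, hY⟩ := hdec _ hlr
  obtain ⟨Z, z, hZ⟩ := hdec _ hrr
  obtain ⟨ξ, hξ⟩ := hw _ (left_mul_mem_pow ht2)
  obtain ⟨η, hη⟩ := hw _ (right_mul_mem_pow ht2)
  -- Associativity: `r (l l) = l (l r)`, and next `r (l r) = l (r r)`. Hence `(X, Y, Z)` is
  -- proportional to `(ξ ^ 2, ξ η, η ^ 2)`.
  have hXY : X * η = Y * ξ := hinj (by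
    rw [map_mul, map_mul]
    linear_combination l * hY - r * hX + algebraMap ℂ Q Y * hξ - algebraMap ℂ Q X * hη +
      algebraMap ℂ Q v * hlw - algebraMap ℂ Q u * hrw)
  have hYZ : Y * η = Z * ξ := hinj (by
    rw [map_mul, map_mul]
    linear_combination l * hZ - r * hY + algebraMap ℂ Q Z * hξ - algebraMap ℂ Q Y * hη +
      algebraMap ℂ Q z * hlw - algebraMap ℂ Q v * hrw)
  have hXYZ : ¬ (X = 0 ∧ Y = 0 ∧ Z = 0) := by
    rintro ⟨rfl, rfl, rfl⟩
    have hcw : ∀ c : ℂ, algebraMap ℂ Q c * w ∈ Ideal.span {l, r} ^ 3 := fun c =>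
      Ideal.mul_mem_left _ _ hw3
    rw [map_zero, zero_mul, zero_add] at hX hY hZ
    obtain ⟨x, y, y', rfl⟩ := exists_of_mem_span_pair_sq ht2
    refine ht3 (add_mem (add_mem ?_ ?_) ?_)
    · rw [pow_two, hX]; exact Ideal.mul_mem_right _ _ (hcw _)
    · rw [hY]; exact Ideal.mul_mem_right _ _ (hcw _)
    · rw [pow_two, hZ]; exact Ideal.mul_mem_right _ _ (hcw _)
  by_cases hξ0 : ξ = 0
  -- If `l` and `r` both annihilated `t`, they would annihilate `I ^ 2`, and `I ^ 3` would vanish.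
  · have hη0 : η ≠ 0 := by
      rintro rfl
      refine h3 (eq_bot_iff.mpr fun y hy => ?_)
      obtain ⟨s, hs, s', hs', rfl⟩ := exists_of_mem_span_pair_pow_succ hy
      obtain ⟨x, c, rfl⟩ := hdec s hs
      obtain ⟨x', c', rfl⟩ := hdec s' hs'
      rw [hξ0, map_zero, zero_mul] at hξ
      rw [map_zero, zero_mul] at hη
      rw [Ideal.mem_bot]
      linear_combination algebraMap ℂ Q x * hξ + algebraMap ℂ Q c * hlw +
        algebraMap ℂ Q x' * hη + algebraMap ℂ Q c' * hrw
    have hX0 : X = 0 := by simpa [hξ0, hη0] using hXY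
    have hY0 : Y = 0 := by simpa [hξ0, hη0] using hYZ
    have hZ0 : Z ≠ 0 := fun h0 => hXYZ ⟨hX0, hY0, h0⟩
    have hinv : algebraMap ℂ Q (Z * η)⁻¹ * (algebraMap ℂ Q Z * algebraMap ℂ Q η) = 1 := by
      rw [← map_mul, ← map_mul, inv_mul_cancel₀ (mul_ne_zero hZ0 hη0), map_one]
    have hwr : w = algebraMap ℂ Q (Z * η)⁻¹ * r ^ 3 := by
      linear_combination -w * hinv - algebraMap ℂ Q (Z * η)⁻¹ * (r * hZ +
        algebraMap ℂ Q Z * hη + algebraMap ℂ Q z * hrw)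
    rw [hX0, map_zero, zero_mul, zero_add, hwr] at hX
    rw [hY0, map_zero, zero_mul, zero_add, hwr] at hY
    refine h.isClassified_of_cubic_right hdim (a := u * (Z * η)⁻¹) (b := v * (Z * η)⁻¹) ?_ ?_ ?_
    · rw [map_mul]; linear_combination hX
    · rw [map_mul]; linear_combination hY
    · linear_combination hzero (right_mul_mem_pow (right_mul_mem_pow hrr))
  -- With this `m`, both `l (r - m l)` and `r (r - m l)` have no `t`-component, while `l ^ 3` has
  -- coefficient `X ξ ≠ 0` and spans `I ^ 3`.
  · obtain ⟨m, hm⟩ : ∃ m : ℂ, η = m * ξ := ⟨η / ξ, (div_mul_cancel₀ _ hξ0).symm⟩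
    have hYm : Y = m * X := mul_right_cancel₀ hξ0 (by rw [← hXY, hm]; ring)
    have hZm : Z = m * Y := mul_right_cancel₀ hξ0 (by rw [← hYZ, hm]; ring)
    have hX0 : X ≠ 0 := fun h0 => hXYZ (by simp [hZm, hYm, h0])
    have hinv : algebraMap ℂ Q (X * ξ)⁻¹ * (algebraMap ℂ Q X * algebraMap ℂ Q ξ) = 1 := by
      rw [← map_mul, ← map_mul, inv_mul_cancel₀ (mul_ne_zero hX0 hξ0), map_one]
    have hwl : w = algebraMap ℂ Q (X * ξ)⁻¹ * l ^ 3 := by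
      linear_combination -w * hinv - algebraMap ℂ Q (X * ξ)⁻¹ * (l * hX +
        algebraMap ℂ Q X * hξ + algebraMap ℂ Q u * hlw)
    rw [hZm, map_mul] at hZ
    rw [hYm, map_mul] at hY hZ
    refine h.isClassified_of_cubic_left hdim (m := m) (a := (v - m * u) * (X * ξ)⁻¹)
      (b := (z - m * v) * (X * ξ)⁻¹) ?_ ?_ ?_
    · rw [map_mul, map_sub, map_mul]
      linear_combination hY - algebraMap ℂ Q m * hX +
        (algebraMap ℂ Q v - algebraMap ℂ Q m * algebraMap ℂ Q u) * hwl
    · rw [map_mul, map_sub, map_mul]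
      linear_combination hZ - algebraMap ℂ Q m * hY +
        (algebraMap ℂ Q z - algebraMap ℂ Q m * algebraMap ℂ Q v) * hwl
    · linear_combination hzero (left_mul_mem_pow (left_mul_mem_pow hll))

/-- When `l` and `r` are independent modulo `I ^ 2`, the chain `I ^ 2 < I ^ 2 + ℂ l < I < Q` is
strict, so `dim I ^ 2 ≤ 2`. Powers of `I` drop strictly until zero, hence `dim I ^ 3 ≤ 1` and `I ^ 4
= 0`. -/
theorem HasModel.isClassified [FiniteDimensional ℂ Q] [Nontrivial Q] (h : HasModel A l r)
    (hdim : Module.finrank ℂ A = 6) (hQ : Module.finrank ℂ Q ≤ 5) : IsClassified A := by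
  by_cases hlm : l ∈ Ideal.span {l, r} ^ 2
  · exact h.isClassified_of_left_mem hdim hQ hlm
  by_cases hrm : ∃ m : ℂ, r - algebraMap ℂ Q m * l ∈ Ideal.span {l, r} ^ 2
  · obtain ⟨m, hm⟩ := hrm
    exact h.isClassified_of_right_mem hdim hQ hm
  have hnil : IsNilpotent (Ideal.span {l, r}) := by
    obtain ⟨a, ι, hp⟩ := h
    exact isNilpotent_span_pair hp.nilpotent_left hp.nilpotent_right
  have hl1 : l ∈ Ideal.span {l, r} := Ideal.subset_span (by simp)
  have hr1 : r ∈ Ideal.span {l, r} := Ideal.subset_span (by simp)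
  have h2 : Module.finrank ℂ ((Ideal.span {l, r} ^ 2).restrictScalars ℂ) ≤ 2 := by
    have e1 : (Ideal.span {l, r} ^ 2).restrictScalars ℂ <
        (Ideal.span {l, r} ^ 2).restrictScalars ℂ ⊔ Submodule.span ℂ {l} :=
      lt_of_le_of_ne le_sup_left fun heq => hlm (by
        have : l ∈ (Ideal.span {l, r} ^ 2).restrictScalars ℂ := heq ▸
          Submodule.mem_sup_right (Submodule.mem_span_singleton_self l)
        exact this)
    have e2 : (Ideal.span {l, r} ^ 2).restrictScalars ℂ ⊔ Submodule.span ℂ {l} <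
        (Ideal.span {l, r}).restrictScalars ℂ := by
      refine lt_of_le_of_ne (sup_le (fun _ hx =>
        Ideal.pow_le_self two_ne_zero hx) (by simpa using hl1)) fun heq => hrm ?_
      have hr2 : r ∈ (Ideal.span {l, r} ^ 2).restrictScalars ℂ ⊔ Submodule.span ℂ {l} := by
        rw [heq]; exact hr1
      obtain ⟨x, hx, y, hy, hxy⟩ := Submodule.mem_sup.mp hr2
      obtain ⟨m, rfl⟩ := Submodule.mem_span_singleton.mp hy
      refine ⟨m, ?_⟩
      rw [← Algebra.smul_def, ← eq_sub_of_add_eq hxy]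
      exact hx
    have e3 : (Ideal.span {l, r}).restrictScalars ℂ < (⊤ : Submodule ℂ Q) := by
      rw [lt_top_iff_ne_top]
      intro heq
      obtain ⟨n, hn⟩ := hnil
      have : Ideal.span {l, r} = ⊤ := Submodule.restrictScalars_injective ℂ _ _ (by simpa using heq)
      rw [this, Ideal.top_pow] at hn
      exact top_ne_bot hn
    have := Submodule.finrank_lt_finrank_of_lt e1
    have := Submodule.finrank_lt_finrank_of_lt e2
    have := Submodule.finrank_lt_finrank_of_lt e3
    rw [finrank_top] at this
    omega
  by_cases h3 : Ideal.span {l, r} ^ 3 = ⊥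
  · exact h.isClassified_of_cube_eq_bot hdim h2 h3
  have h2ne : Ideal.span {l, r} ^ 2 ≠ ⊥ := fun h0 => h3 (by rw [pow_succ, h0, Ideal.bot_mul])
  have h23 : Module.finrank ℂ ((Ideal.span {l, r} ^ 3).restrictScalars ℂ) <
      Module.finrank ℂ ((Ideal.span {l, r} ^ 2).restrictScalars ℂ) :=
    finrank_pow_succ_lt hnil h2ne
  have h34 : Module.finrank ℂ ((Ideal.span {l, r} ^ 4).restrictScalars ℂ) <
      Module.finrank ℂ ((Ideal.span {l, r} ^ 3).restrictScalars ℂ) :=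
    finrank_pow_succ_lt hnil h3
  refine h.isClassified_of_cube_ne_bot hdim h2 h3 (by omega) h23 ?_
  have h0 : Module.finrank ℂ ((Ideal.span {l, r} ^ 4).restrictScalars ℂ) = 0 := by omega
  rw [Submodule.finrank_eq_zero] at h0
  exact (Submodule.restrictScalars_eq_bot_iff _ _ _).mp h0

end Classification

end Bicomm

theorem theoremB {A : Type*} [NonUnitalNonAssocRing A] [Module ℂ A]
    [IsScalarTower ℂ A A] [SMulCommClass ℂ A A]
    (hdim : Module.finrank ℂ A = 6)
    (hbicomm : Bicomm.IsBicommutative A)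
    (hnil : Bicomm.IsNilpotentAlgebra A)
    (hgen : Bicomm.IsOneGenerated A) :
    ∃ T : Bicomm.Table, Bicomm.IsListed T ∧ Bicomm.Isomorphic A (Bicomm.TableAlgebra T) := by
  obtain ⟨Q, _, _, l, r, _, hQ, _, h⟩ := Bicomm.exists_hasModel hdim hbicomm hnil hgen
  exact h.isClassified hdim hQ
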